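/- Let $k,n\ge 1$ and $|h|\le n$ be integers. For $k\ge1$ let $\Omega^h_{k,n}$ be the set of families $\eta=(\eta^{(i)}_x)_{1\le i\le k,\,0\le x\le n}$ of integer heights such that $\eta^{(i)}_0=0$, $\eta^{(i)}_n=h$, $\eta^{(i)}_{x+1}-\eta^{(i)}_x\in\{-1,+1\}$ and $\eta^{(i)}_x\ge\eta^{(i+1)}_x$. For $\alpha>0$ let $\mu$ be the probability measure on $\Omega^h_{k,n}$ with $\mu(\eta)\propto\exp\big(\alpha\sum_{i=1}^k\sum_{x=0}^n\eta^{(i)}_x\big)$. Given a ceiling $\xi$ and a floor $\sigma$ in $\Omega^h_{1,n}$ with $\xi\ge\sigma$ pointwise, let $\mu^{\xi,\sigma}$ be $\mu$ conditioned on $E_{\xi,\sigma}=\{\eta:\ \xi\ge\eta^{(1)},\ \eta^{(k)}\ge\sigma\}$. In the heat-bath dynamics on $E_{\xi,\sigma}$, each $(i,x)$, $1\le i\le k$, $1\le x\le n-1$, has an independent rate-$1$ Poisson clock; when it rings, $\eta^{(i)}_x$ is resampled from its conditional $\mu^{\xi,\sigma}$-law given $\eta^{(i)}_{x-1},\eta^{(i)}_{x+1},\eta^{(i-1)}_x,\eta^{(i+1)}_x$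 (with $\eta^{(0)}=\xi$, $\eta^{(k+1)}=\sigma$), all other heights being kept. Let $\mu^\eta_{i,x}(f)$ be the expectation of $f$ after such an update of $\eta$, and set $\mathrm{Var}^\eta_{i,x}(f)=\mu^\eta_{i,x}(f^2)-\mu^\eta_{i,x}(f)^2$, $$\mathcal E(f)=\sum_{i=1}^k\sum_{x=1}^{n-1}\mu^{\xi,\sigma}\big[\mathrm{Var}_{i,x}(f)\big],\qquad \mathrm{gap}=\min_{f:\ \mathrm{Var}(f)\ne0}\frac{\mathcal E(f)}{\mathrm{Var}(f)},$$ where $\mathrm{Var}$ is the variance under $\mu^{\xi,\sigma}$ (and $\mathrm{gap}=+\infty$ if $E_{\xi,\sigma}$ is a single point). **Theorem.** For every $\alpha>0$ there is a constant $c(\alpha)>0$, depending only on $\alpha$, such that the following hold. (a) $\mathrm{gap}\ge c(\alpha)$ for all $k,n\ge1$, all integers $h$ with $|h|\le n$, and all $\xi\ge\sigma$ in $\Omega^h_{1,n}$. (b) Equivalently, in terms of boxed plane partitions: let $a,b,c\ge0$ be integers and consider the arrays $(\ell_{x,y})_{0\le x<a,\,0\le y<b}$ of integers in $\{0,\dots,c\}$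 that are non-increasing in $x$ and in $y$, with the probability measure proportional to $e^{-2\alpha\sum_{x,y}\ell_{x,y}}$. Consider the continuous-time dynamics in which each $(x,y)$ has an independent rate-$1$ Poisson clock and, when it rings, $\ell_{x,y}$ is replaced by $\ell_{x,y}+1$ with probability $p$ and by $\ell_{x,y}-1$ with probability $1-p$, where $p/(1-p)=e^{-2\alpha}$, the move being cancelled if the result is not such an array. The spectral gap of this dynamics, i.e. the minimum over $f$ of nonzero variance of the Dirichlet form (minus the mean of $f$ times the generator applied to $f$) divided by the variance of $f$, is at least $c(\alpha)$ for all $a,b,c$ (again with the convention $+\infty$ for a one-point state space). -/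

import Mathlib

noncomputable section

namespace BiasedPaths

open Classical

/-- A single polymer (path) of length `n` is recorded by its integer heights at `0, …, n`. -/
abbrev Path (n : ℕ) : Type := Fin (n + 1) → ℤ

/-- A collection of `k` polymers: the index `i : Fin k` stands for the `(i + 1)`-st polymer,
so that index `0` is the top one. -/
abbrev Config (k n : ℕ) : Type := Fin k → Path n

/-- Nearest-neighbour path from height `0` to height `h`, with all increments `±1`. -/
def IsPath (n : ℕ) (h : ℤ) (p : Path n) : Prop :=
  p 0 = 0 ∧ p (Fin.last n) = h ∧
    ∀ x : Fin n, p x.succ - p x.castSucc = 1 ∨ p x.succ - p x.castSucc = -1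

/-- `k` ordered paths: a polymer with larger index lies (weakly) below. -/
def IsConfig (k n : ℕ) (h : ℤ) (η : Config k n) : Prop :=
  (∀ i, IsPath n h (η i)) ∧ ∀ i j : Fin k, i ≤ j → ∀ x, η j x ≤ η i x

/-- The finite set `Ω^h_{k,n}` of configurations (see `mem_Omega`). -/
def Omega (k n : ℕ) (h : ℤ) : Finset (Config k n) :=
  (Fintype.piFinset fun _ => Fintype.piFinset fun _ =>
    Finset.Icc (-(n : ℤ)) (n : ℤ)).filter (IsConfig k n h)

theorem IsPath.height_bound {n : ℕ} {h : ℤ} {p : Path n} (hp : IsPath n h p) :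
    ∀ (m : ℕ) (hm : m < n + 1), |p ⟨m, hm⟩| ≤ m := by
  intro m
  induction m with
  | zero =>
    intro hm
    have h0 : p ⟨0, hm⟩ = 0 := hp.1
    simp only [h0, abs_zero, Nat.cast_zero, le_refl]
  | succ m ih =>
    intro hm
    have h1 := abs_le.1 (ih (by omega))
    have h2 := hp.2.2 ⟨m, by omega⟩
    simp only [Fin.succ_mk, Fin.castSucc_mk] at h2
    rw [abs_le]
    push_cast
    constructor <;> rcases h2 with h2 | h2 <;> linarith [h1.1, h1.2]

/-- The a priori bound on heights used in `Omega` excludes nothing. -/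
theorem mem_Omega {k n : ℕ} {h : ℤ} {η : Config k n} :
    η ∈ Omega k n h ↔ IsConfig k n h η := by
  constructor
  · intro hη
    exact (Finset.mem_filter.1 hη).2
  · intro hη
    refine Finset.mem_filter.2 ⟨?_, hη⟩
    rw [Fintype.mem_piFinset]
    intro i
    rw [Fintype.mem_piFinset]
    intro x
    have h1 := abs_le.1 (IsPath.height_bound (hη.1 i) x.1 x.2)
    have h2 : (x.1 : ℤ) ≤ n := by exact_mod_cast Nat.lt_succ_iff.1 x.2
    rw [Finset.mem_Icc]
    constructor <;> linarith [h1.1, h1.2]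

/-- The unnormalized weight `exp (α ∑ᵢ ∑ₓ η⁽ⁱ⁾ₓ)`. -/
def weight {k n : ℕ} (α : ℝ) (η : Config k n) : ℝ :=
  Real.exp (α * ∑ i, ∑ x, (η i x : ℝ))

/-- The partition function. -/
def Z (k n : ℕ) (h : ℤ) (α : ℝ) : ℝ := ∑ η ∈ Omega k n h, weight α η

/-- The equilibrium measure `μ` on `Ω^h_{k,n}` (without ceiling and floor), as a mass function. -/
def mu (k n : ℕ) (h : ℤ) (α : ℝ) (η : Config k n) : ℝ :=
  if η ∈ Omega k n h then weight α η / Z k n h α else 0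

/-- The configurations lying below the ceiling `ξ` and above the floor `σ`. Since the polymers are
ordered, this is the same as `ξ ≥ η⁽¹⁾` and `η⁽ᵏ⁾ ≥ σ`. -/
def E (k n : ℕ) (h : ℤ) (ξ σ : Path n) : Finset (Config k n) :=
  (Omega k n h).filter fun η => ∀ i x, σ x ≤ η i x ∧ η i x ≤ ξ x

/-- `μ^{ξ,σ}`: the measure `μ` conditioned on `E`. -/
def muCond (k n : ℕ) (h : ℤ) (α : ℝ) (ξ σ : Path n) (η : Config k n) : ℝ :=
  if η ∈ E k n h ξ σ then mu k n h α η / ∑ ζ ∈ E k n h ξ σ, mu k n h α ζ else 0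

/-- The `μ^{ξ,σ}`-probability of an event. -/
def prob (k n : ℕ) (h : ℤ) (α : ℝ) (ξ σ : Path n) (A : Config k n → Prop) : ℝ :=
  ∑ η ∈ (E k n h ξ σ).filter A, muCond k n h α ξ σ η

/-- The `μ^{ξ,σ}`-expectation of `f`. -/
def expect (k n : ℕ) (h : ℤ) (α : ℝ) (ξ σ : Path n) (f : Config k n → ℝ) : ℝ :=
  ∑ η ∈ E k n h ξ σ, muCond k n h α ξ σ η * f η

/-- The variance of `f` under `μ^{ξ,σ}`. -/
def variance (k n : ℕ) (h : ℤ) (α : ℝ) (ξ σ : Path n) (f : Config k n → ℝ) : ℝ :=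
  expect k n h α ξ σ (fun η => f η ^ 2) - expect k n h α ξ σ f ^ 2

/-- `ζ` and `η` have the same heights at the (at most four) neighbours `(i, x - 1)`, `(i, x + 1)`,
`(i - 1, x)`, `(i + 1, x)` of `(i, x)`. The ceiling and the floor, which play the role of the
polymers just before the first and just after the last one, are deterministic, so that
they contribute no condition. -/
def AgreeNbrs {k n : ℕ} (i : Fin k) (x : Fin (n + 1)) (η ζ : Config k n) : Prop :=
  (∀ y : Fin (n + 1), (y.val + 1 = x.val ∨ y.val = x.val + 1) → ζ i y = η i y) ∧
    ∀ j : Fin k, (j.val + 1 = i.val ∨ j.val = i.val + 1) → ζ j x = η j x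

/-- The law of the new height at `(i, x)`: the conditional probability, under `μ^{ξ,σ}`, that the
height at `(i, x)` is `v`, given the neighbouring heights of `η`. -/
def heightLaw (k n : ℕ) (h : ℤ) (α : ℝ) (ξ σ : Path n) (i : Fin k) (x : Fin (n + 1))
    (η : Config k n) (v : ℤ) : ℝ :=
  prob k n h α ξ σ (fun ζ => AgreeNbrs i x η ζ ∧ ζ i x = v) /
    prob k n h α ξ σ (fun ζ => AgreeNbrs i x η ζ)

/-- The configuration `η` with its height at `(i, x)` replaced by `v`. -/
def setHeight {k n : ℕ} (η : Config k n) (i : Fin k) (x : Fin (n + 1)) (v : ℤ) : Config k n :=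
  Function.update η i (Function.update (η i) x v)

/-- `μ^η_{i,x}(f)`: the expectation of `f` after a heat-bath update of `η` at `(i, x)`. -/
def localExpect (k n : ℕ) (h : ℤ) (α : ℝ) (ξ σ : Path n) (i : Fin k) (x : Fin (n + 1))
    (f : Config k n → ℝ) (η : Config k n) : ℝ :=
  ∑ v ∈ Finset.Icc (-(n : ℤ)) (n : ℤ), heightLaw k n h α ξ σ i x η v * f (setHeight η i x v)

/-- The local variance `Var^η_{i,x}(f)`. -/
def localVariance (k n : ℕ) (h : ℤ) (α : ℝ) (ξ σ : Path n) (i : Fin k) (x : Fin (n + 1))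
    (f : Config k n → ℝ) (η : Config k n) : ℝ :=
  localExpect k n h α ξ σ i x (fun ζ => f ζ ^ 2) η - localExpect k n h α ξ σ i x f η ^ 2

/-- The Dirichlet form of the heat-bath dynamics: every `(i, x)` with `1 ≤ x ≤ n - 1` has a
rate-one clock. -/
def dirichlet (k n : ℕ) (h : ℤ) (α : ℝ) (ξ σ : Path n) (f : Config k n → ℝ) : ℝ :=
  ∑ i : Fin k, ∑ x ∈ Finset.univ.filter (fun x : Fin (n + 1) => 1 ≤ x.val ∧ x.val ≤ n - 1),
    expect k n h α ξ σ (localVariance k n h α ξ σ i x f)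

/-- The spectral gap, the minimum of `dirichlet f / variance f` over all `f` of nonzero variance.
It is `⊤` when there is no such `f`, i.e. when the state space is a single point. -/
def gap (k n : ℕ) (h : ℤ) (α : ℝ) (ξ σ : Path n) : EReal :=
  ⨅ (f : Config k n → ℝ) (_ : variance k n h α ξ σ f ≠ 0),
    ((dirichlet k n h α ξ σ f / variance k n h α ξ σ f : ℝ) : EReal)

end BiasedPaths

namespace BoxedPlanePartition

open Classical

/-- The plane partitions in the box `a × b × c`. -/
def states (a b c : ℕ) : Finset (Fin a → Fin b → ℤ) :=
  (Fintype.piFinset fun _ => Fintype.piFinset fun _ => Finset.Icc (0 : ℤ) (c : ℤ)).filter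
    fun l => (∀ x x' y, x ≤ x' → l x' y ≤ l x y) ∧ ∀ x y y', y ≤ y' → l x y' ≤ l x y

/-- The weight `exp (-2 α Vol)`, where `Vol` is the volume under the surface. -/
def weight {a b : ℕ} (α : ℝ) (l : Fin a → Fin b → ℤ) : ℝ :=
  Real.exp (-2 * α * ∑ x, ∑ y, (l x y : ℝ))

/-- The expectation of `f` under the probability measure proportional to `weight`. -/
def expect (a b c : ℕ) (α : ℝ) (f : (Fin a → Fin b → ℤ) → ℝ) : ℝ :=
  (∑ l ∈ states a b c, weight α l * f l) / ∑ l ∈ states a b c, weight α l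

def variance (a b c : ℕ) (α : ℝ) (f : (Fin a → Fin b → ℤ) → ℝ) : ℝ :=
  expect a b c α (fun l => f l ^ 2) - expect a b c α f ^ 2

/-- Replace `l x y` by `l x y + d` if the result is allowed; otherwise do nothing. -/
def flip {a b : ℕ} (c : ℕ) (l : Fin a → Fin b → ℤ) (x : Fin a) (y : Fin b) (d : ℤ) :
    Fin a → Fin b → ℤ :=
  if Function.update l x (Function.update (l x) y (l x y + d)) ∈ states a b c then
    Function.update l x (Function.update (l x) y (l x y + d))
  else l

/-- The probability of an upward flip, so that `pUp α / (1 - pUp α) = exp (-2 α)`. -/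
def pUp (α : ℝ) : ℝ := Real.exp (-2 * α) / (1 + Real.exp (-2 * α))

/-- The generator of the flip dynamics: at rate one, each column attempts an upward flip with
probability `pUp α` and a downward flip with probability `1 - pUp α`. -/
def generator (a b c : ℕ) (α : ℝ) (f : (Fin a → Fin b → ℤ) → ℝ) (l : Fin a → Fin b → ℤ) : ℝ :=
  ∑ x, ∑ y, (pUp α * (f (flip c l x y 1) - f l) +
    (1 - pUp α) * (f (flip c l x y (-1)) - f l))

def dirichlet (a b c : ℕ) (α : ℝ) (f : (Fin a → Fin b → ℤ) → ℝ) : ℝ :=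
  -expect a b c α (fun l => f l * generator a b c α f l)

/-- The spectral gap of the flip dynamics (`⊤` when the state space is a single point). -/
def gap (a b c : ℕ) (α : ℝ) : EReal :=
  ⨅ (f : (Fin a → Fin b → ℤ) → ℝ) (_ : variance a b c α f ≠ 0),
    ((dirichlet a b c α f / variance a b c α f : ℝ) : EReal)

end BoxedPlanePartition

end

/-! Both models are encoded as one: arrays of heights in {0, ..., c} on a planar set of cells,
increasing upwards along two diagonal directions, where raising one height by 1 multiplies the
weight by q = r^2 with r = exp(-α). For polymers, the height of a cell between floor and ceiling is
the number of polymers passing below it, so that pushing a polymer down across a cell raises one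
height. A plane partition is such an array after a rotation of its index rectangle.

For arrays, consider first the dynamics that resamples the whole height at a cell. The new height is
geometric with ratio q on an interval [lo, hi] given by the neighbours, and the mean of q^v under
this law is exactly (q^lo + q * q^hi)/(1 + q) (`geometric_sum_sq`). Take the potential V(l) = ∑ r^y
q^(l(x,y)). For ordered arrays l ≤ l', the identity q^max + q^min = q^a + q^b and the absence of
gaps in the domain bound the change of V(l) - V(l') (`drift_le`): the difference decays at rate at
least 1 - 2r/(1 + r^2) = (1 - r)^2/(1 + r^2), whatever the domain and c.

The resampling preserves monotonicity, so the Lipschitz constant of any observable relative to V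
decays at the same rate (`IsFamily.abs_step_sub_le`). By symmetry of the dynamics this becomes an
L^2 bound (`quadratic_form_le_of_contraction`), hence a spectral gap (`IsFamily.heatBath_gap`). A
Hardy inequality for geometric weights (`IsFamily.heatBath_form_le`) replaces resampling by unit
moves at a cost depending on q only. Finally the unit moves are the flips of the two original
dynamics, whose Dirichlet forms are bounded below by sums over flips
(`BiasedPaths.flips_le_dirichlet`, `BoxedPlanePartition.dirichlet_eq`). -/

noncomputable section

/-! ### Conditional averages, and L^2 bounds from decay of oscillations. -/

namespace SkewArray

open Classical

/-- The weighted average of `f` over the points of `X` with the same `key` as `ω`. -/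
def condAvg {Ω κ : Type*} (X : Finset Ω) (w : Ω → ℝ) (key : Ω → κ) (f : Ω → ℝ) (ω : Ω) : ℝ :=
  (∑ ω' ∈ X.filter (fun ω' => key ω' = key ω), w ω' * f ω') /
    ∑ ω' ∈ X.filter (fun ω' => key ω' = key ω), w ω'

section condAvg

variable {Ω κ : Type*} {X : Finset Ω} {w : Ω → ℝ} {key : Ω → κ}

theorem condAvg_mass_pos (hw : ∀ ω ∈ X, 0 < w ω) {ω : Ω} (hω : ω ∈ X) :
    0 < ∑ ω' ∈ X.filter (fun ω' => key ω' = key ω), w ω' :=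
  Finset.sum_pos (fun ω' h => hw ω' (Finset.mem_filter.1 h).1)
    ⟨ω, Finset.mem_filter.2 ⟨hω, rfl⟩⟩

theorem condAvg_congr_key (f : Ω → ℝ) {ω ω' : Ω} (h : key ω = key ω') :
    condAvg X w key f ω = condAvg X w key f ω' := by
  unfold condAvg
  rw [h]

theorem condAvg_add (f g : Ω → ℝ) (ω : Ω) :
    condAvg X w key (fun ω => f ω + g ω) ω = condAvg X w key f ω + condAvg X w key g ω := by
  unfold condAvg
  rw [← add_div, ← Finset.sum_add_distrib]
  simp only [mul_add]

theorem condAvg_const_mul (a : ℝ) (f : Ω → ℝ) (ω : Ω) :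
    condAvg X w key (fun ω => a * f ω) ω = a * condAvg X w key f ω := by
  unfold condAvg
  rw [← mul_div_assoc, Finset.mul_sum]
  simp only [mul_left_comm]

theorem condAvg_sub (f g : Ω → ℝ) (ω : Ω) :
    condAvg X w key (fun ω => f ω - g ω) ω = condAvg X w key f ω - condAvg X w key g ω := by
  unfold condAvg
  rw [← sub_div, ← Finset.sum_sub_distrib]
  simp only [mul_sub]

theorem condAvg_of_invariant (hw : ∀ ω ∈ X, 0 < w ω) {f : Ω → ℝ}
    (hf : ∀ ω ∈ X, ∀ ω' ∈ X, key ω' = key ω → f ω' = f ω) {ω : Ω} (hω : ω ∈ X) :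
    condAvg X w key f ω = f ω := by
  have h := condAvg_mass_pos (key := key) hw hω
  unfold condAvg
  rw [div_eq_iff h.ne', Finset.mul_sum]
  refine Finset.sum_congr rfl fun ω' h' => ?_
  rw [hf ω hω ω' (Finset.mem_filter.1 h').1 (Finset.mem_filter.1 h').2, mul_comm]

/-- Self-adjointness: both sides are sums over pairs with equal key of the kernel w(ω) w(ω') / mass,
which is symmetric. -/
theorem sum_condAvg_mul (f g : Ω → ℝ) :
    ∑ ω ∈ X, w ω * condAvg X w key f ω * g ω = ∑ ω ∈ X, w ω * f ω * condAvg X w key g ω := by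
  have h1 : ∀ ω ∈ X, w ω * condAvg X w key f ω * g ω = ∑ ω' ∈ X, if key ω' = key ω then
      w ω * (w ω' * f ω') * g ω / ∑ ω'' ∈ X.filter (fun ω'' => key ω'' = key ω), w ω'' else 0 := by
    intro ω _
    rw [← Finset.sum_filter, ← Finset.sum_div, ← Finset.sum_mul, ← Finset.mul_sum]
    unfold condAvg
    ring
  have h2 : ∀ ω ∈ X, w ω * f ω * condAvg X w key g ω = ∑ ω' ∈ X, if key ω' = key ω then
      w ω * f ω * (w ω' * g ω') / ∑ ω'' ∈ X.filter (fun ω'' => key ω'' = key ω), w ω'' else 0 := by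
    intro ω _
    rw [← Finset.sum_filter, ← Finset.sum_div, ← Finset.mul_sum]
    unfold condAvg
    ring
  rw [Finset.sum_congr rfl h1, Finset.sum_congr rfl h2, Finset.sum_comm]
  refine Finset.sum_congr rfl fun ω _ => Finset.sum_congr rfl fun ω' _ => ?_
  by_cases h : key ω = key ω'
  · rw [if_pos h, if_pos h.symm, h]
    ring
  · rw [if_neg h, if_neg (Ne.symm h)]

/-- Averaging is a self-adjoint projection, so its quadratic form at f is the squared norm of the
average of f. -/
theorem sum_mul_condAvg_nonneg (hw : ∀ ω ∈ X, 0 < w ω) (f : Ω → ℝ) :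
    0 ≤ ∑ ω ∈ X, w ω * f ω * condAvg X w key f ω := by
  have h : ∑ ω ∈ X, w ω * f ω * condAvg X w key f ω =
      ∑ ω ∈ X, w ω * condAvg X w key f ω * condAvg X w key f ω := by
    rw [sum_condAvg_mul]
    refine Finset.sum_congr rfl fun ω hω => ?_
    rw [condAvg_of_invariant hw (fun _ _ _ _ h => condAvg_congr_key f h) hω]
  rw [h]
  refine Finset.sum_nonneg fun ω hω => ?_
  rw [mul_assoc]
  exact mul_nonneg (hw ω hω).le (mul_self_nonneg _)

/-- The conditional variance is at most the second moment around any function of the key. -/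
theorem sum_mul_sub_condAvg_le (hw : ∀ ω ∈ X, 0 < w ω) (f b : Ω → ℝ)
    (hb : ∀ ω ∈ X, ∀ ω' ∈ X, key ω' = key ω → b ω' = b ω) :
    ∑ ω ∈ X, w ω * f ω * (f ω - condAvg X w key f ω) ≤ ∑ ω ∈ X, w ω * (f ω - b ω) ^ 2 := by
  -- The right side minus the left side of the claim is exactly the quadratic form of the averaging
  -- at f - b.
  have h0 := sum_mul_condAvg_nonneg (key := key) hw (fun ω => f ω - b ω)
  have h1 : ∑ ω ∈ X, w ω * f ω * condAvg X w key b ω = ∑ ω ∈ X, w ω * f ω * b ω :=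
    Finset.sum_congr rfl fun ω hω => by rw [condAvg_of_invariant hw hb hω]
  have h2 : ∑ ω ∈ X, w ω * b ω * condAvg X w key b ω = ∑ ω ∈ X, w ω * b ω * b ω :=
    Finset.sum_congr rfl fun ω hω => by rw [condAvg_of_invariant hw hb hω]
  have h3 : ∑ ω ∈ X, w ω * b ω * condAvg X w key f ω = ∑ ω ∈ X, w ω * f ω * b ω := by
    rw [← sum_condAvg_mul]
    refine Finset.sum_congr rfl fun ω hω => ?_
    rw [condAvg_of_invariant hw hb hω]
    ring
  have h4 : ∑ ω ∈ X, w ω * (f ω - b ω) * condAvg X w key (fun ω => f ω - b ω) ω =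
      ∑ ω ∈ X, w ω * f ω * condAvg X w key f ω - ∑ ω ∈ X, w ω * f ω * condAvg X w key b ω
      - ∑ ω ∈ X, w ω * b ω * condAvg X w key f ω
      + ∑ ω ∈ X, w ω * b ω * condAvg X w key b ω := by
    rw [← Finset.sum_sub_distrib, ← Finset.sum_sub_distrib, ← Finset.sum_add_distrib]
    refine Finset.sum_congr rfl fun ω _ => ?_
    rw [condAvg_sub]
    ring
  have h5 : ∑ ω ∈ X, w ω * (f ω - b ω) ^ 2 - ∑ ω ∈ X, w ω * f ω * (f ω - condAvg X w key f ω) =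
      ∑ ω ∈ X, w ω * f ω * condAvg X w key f ω - ∑ ω ∈ X, w ω * f ω * b ω
      - ∑ ω ∈ X, w ω * f ω * b ω + ∑ ω ∈ X, w ω * b ω * b ω := by
    rw [← Finset.sum_sub_distrib, ← Finset.sum_sub_distrib, ← Finset.sum_sub_distrib,
      ← Finset.sum_add_distrib]
    refine Finset.sum_congr rfl fun ω _ => ?_
    ring
  rw [h4, h1, h2, h3] at h0
  linarith

end condAvg

theorem sum_mul_sub_mean_sq {Ω : Type*} {X : Finset Ω} {w : Ω → ℝ} (hw1 : ∑ ω ∈ X, w ω = 1)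
    (f : Ω → ℝ) : ∑ ω ∈ X, w ω * (f ω - ∑ ω' ∈ X, w ω' * f ω') ^ 2 =
      ∑ ω ∈ X, w ω * f ω ^ 2 - (∑ ω ∈ X, w ω * f ω) ^ 2 := by
  set a := ∑ ω ∈ X, w ω * f ω with ha
  have : ∀ ω, w ω * (f ω - a) ^ 2 = w ω * f ω ^ 2 - 2 * a * (w ω * f ω) + a ^ 2 * w ω :=
    fun ω => by ring
  simp only [this, Finset.sum_add_distrib, Finset.sum_sub_distrib, ← Finset.mul_sum, hw1]
  rw [← ha]
  ring

theorem variance_nonneg {Ω : Type*} {X : Finset Ω} {w : Ω → ℝ} (hw : ∀ ω ∈ X, 0 < w ω)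
    (hw1 : ∑ ω ∈ X, w ω = 1) (f : Ω → ℝ) :
    0 ≤ ∑ ω ∈ X, w ω * f ω ^ 2 - (∑ ω ∈ X, w ω * f ω) ^ 2 := by
  rw [← sum_mul_sub_mean_sq hw1]
  exact Finset.sum_nonneg fun ω hω => mul_nonneg (hw ω hω).le (sq_nonneg _)

/-- A log-convex sequence which is `O(Rⁿ)` has first ratio at most `R`. -/
theorem le_mul_of_logConvex {b : ℕ → ℝ} {R C : ℝ} (hR : 0 < R) (hb : ∀ n, 0 ≤ b n)
    (hc : ∀ n, b (n + 1) ^ 2 ≤ b n * b (n + 2)) (hC : ∀ n, b n ≤ C * R ^ n) :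
    b 1 ≤ R * b 0 := by
  by_contra! hlt
  have h0 : 0 < b 0 := by
    rcases (hb 0).lt_or_eq with h | h
    · exact h
    · have := hc 0
      rw [← h] at this hlt
      nlinarith
  set t := b 1 / b 0 with ht
  have htR : R < t := by rwa [ht, lt_div_iff₀ h0]
  have ht0 : 0 < t := hR.trans htR
  -- Log-convexity makes the successive ratios nondecreasing, so a first ratio t > R forces growth
  -- at least like t^n.
  have hstep : ∀ n, 0 < b n ∧ t * b n ≤ b (n + 1) := by
    intro n
    induction n with
    | zero => exact ⟨h0, by rw [ht, div_mul_cancel₀ _ h0.ne']⟩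
    | succ n ih =>
      obtain ⟨h1, h2⟩ := ih
      have h3 : 0 < b (n + 1) := lt_of_lt_of_le (mul_pos ht0 h1) h2
      refine ⟨h3, ?_⟩
      have h4 := hc n
      have h5 : b n * (t * b (n + 1)) ≤ b n * b (n + 1 + 1) := by
        nlinarith
      exact le_of_mul_le_mul_left h5 h1
  have hgrow : ∀ n, b 0 * t ^ n ≤ b n := by
    intro n
    induction n with
    | zero => simp
    | succ n ih =>
      calc b 0 * t ^ (n + 1) = t * (b 0 * t ^ n) := by ring
        _ ≤ t * b n := by gcongr
        _ ≤ b (n + 1) := (hstep n).2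
  obtain ⟨n, hn⟩ := pow_unbounded_of_one_lt (C / b 0) ((one_lt_div hR).2 htR)
  rw [div_pow, div_lt_div_iff₀ h0 (pow_pos hR n)] at hn
  have := hgrow n
  have := hC n
  linarith

/-- If a symmetric averaging operator shrinks oscillations by a factor `ρ` per step (up to a
constant), then its quadratic form is at most `ρ` on functions of mean zero. -/
theorem quadratic_form_le_of_contraction {Ω : Type*} {X : Finset Ω} {w : Ω → ℝ}
    (hw : ∀ ω ∈ X, 0 < w ω) (hw1 : ∑ ω ∈ X, w ω = 1) {P : (Ω → ℝ) → Ω → ℝ}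
    (hsym : ∀ f g, ∑ ω ∈ X, w ω * P f ω * g ω = ∑ ω ∈ X, w ω * f ω * P g ω)
    (hmean : ∀ f, ∑ ω ∈ X, w ω * P f ω = ∑ ω ∈ X, w ω * f ω) {ρ : ℝ} (hρ : 0 < ρ)
    {f : Ω → ℝ} (hf : ∑ ω ∈ X, w ω * f ω = 0) {C : ℝ}
    (hosc : ∀ n, ∀ ω ∈ X, ∀ ω' ∈ X, |(P^[n] f) ω - (P^[n] f) ω'| ≤ C * ρ ^ n) :
    ∑ ω ∈ X, w ω * f ω * P f ω ≤ ρ * ∑ ω ∈ X, w ω * f ω ^ 2 := by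
  -- b n is the squared norm of P^n f. By symmetry b (n + 1) is the inner product of P^n f and
  -- P^(n+2) f, so Cauchy-Schwarz gives log-convexity. The decay of oscillations then bounds the
  -- first ratio by ρ^2, without diagonalizing P.
  set b : ℕ → ℝ := fun n => ∑ ω ∈ X, w ω * (P^[n] f) ω ^ 2 with hbdef
  have hCS : ∀ g h : Ω → ℝ, (∑ ω ∈ X, w ω * g ω * h ω) ^ 2 ≤
      (∑ ω ∈ X, w ω * g ω ^ 2) * ∑ ω ∈ X, w ω * h ω ^ 2 := by
    intro g h
    have := Finset.sum_mul_sq_le_sq_mul_sq X (fun ω => √(w ω) * g ω) (fun ω => √(w ω) * h ω)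
    refine le_trans (le_of_eq ?_) (this.trans (le_of_eq ?_))
    · congr 1
      refine Finset.sum_congr rfl fun ω hω => ?_
      linear_combination (-(g ω * h ω)) * Real.mul_self_sqrt (hw ω hω).le
    · congr 1 <;>
      · refine Finset.sum_congr rfl fun ω hω => ?_
        rw [mul_pow, Real.sq_sqrt (hw ω hω).le]
  have hb : ∀ n, 0 ≤ b n := fun n =>
    Finset.sum_nonneg fun ω hω => mul_nonneg (hw ω hω).le (sq_nonneg _)
  have hc : ∀ n, b (n + 1) ^ 2 ≤ b n * b (n + 2) := by
    intro n
    have h1 : b (n + 1) = ∑ ω ∈ X, w ω * (P^[n] f) ω * (P^[n + 2] f) ω := by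
      rw [Function.iterate_succ_apply' P (n + 1) f, ← hsym]
      simp only [hbdef, Function.iterate_succ_apply' P n f]
      exact Finset.sum_congr rfl fun ω _ => by ring
    rw [h1]
    exact hCS _ _
  have hz : ∀ n, ∑ ω ∈ X, w ω * (P^[n] f) ω = 0 := by
    intro n
    induction n with
    | zero => exact hf
    | succ n ih => rw [Function.iterate_succ_apply', hmean, ih]
  have hC : ∀ n, b n ≤ C ^ 2 * (ρ ^ 2) ^ n := by
    intro n
    have h1 : ∀ ω ∈ X, |(P^[n] f) ω| ≤ C * ρ ^ n := by
      intro ω hω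
      -- The mean is zero, so a value is a weighted average of differences of values.
      have h2 : (P^[n] f) ω = ∑ ω' ∈ X, w ω' * ((P^[n] f) ω - (P^[n] f) ω') := by
        simp only [mul_sub, Finset.sum_sub_distrib, hz n, ← Finset.sum_mul, hw1]
        ring
      rw [h2]
      calc |∑ ω' ∈ X, w ω' * ((P^[n] f) ω - (P^[n] f) ω')|
          ≤ ∑ ω' ∈ X, |w ω' * ((P^[n] f) ω - (P^[n] f) ω')| := Finset.abs_sum_le_sum_abs _ _
        _ ≤ ∑ ω' ∈ X, w ω' * (C * ρ ^ n) := by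
          refine Finset.sum_le_sum fun ω' hω' => ?_
          rw [abs_mul, abs_of_pos (hw ω' hω')]
          exact mul_le_mul_of_nonneg_left (hosc n ω hω ω' hω') (hw ω' hω').le
        _ = C * ρ ^ n := by rw [← Finset.sum_mul, hw1, one_mul]
    calc b n ≤ ∑ ω ∈ X, w ω * (C * ρ ^ n) ^ 2 := by
          refine Finset.sum_le_sum fun ω hω => mul_le_mul_of_nonneg_left ?_ (hw ω hω).le
          rw [← sq_abs]
          exact pow_le_pow_left₀ (abs_nonneg _) (h1 ω hω) 2
      _ = C ^ 2 * (ρ ^ 2) ^ n := by rw [← Finset.sum_mul, hw1]; ring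
  have key := le_mul_of_logConvex (pow_pos hρ 2) hb hc hC
  have h1 := hCS f (P f)
  have h2 : b 0 = ∑ ω ∈ X, w ω * f ω ^ 2 := rfl
  have h3 : b 1 = ∑ ω ∈ X, w ω * P f ω ^ 2 := rfl
  rw [← h2, ← h3] at h1
  rw [← h2]
  refine le_of_sq_le_sq (h1.trans ?_) (mul_nonneg hρ.le (hb 0))
  nlinarith [hb 0]

end SkewArray

end

/-! ### Monotone arrays, resampling of one cell, and its effect on the potential. -/

noncomputable section

namespace SkewArray

open Classical

/-- Arrays of heights in `{0, …, c}` on the cells of `S`, extended by zero. The cell `(x, m)` lies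
above the cells `(x - 1, m - 1)` and `(x + 1, m - 1)`, and heights increase upwards. -/
structure IsArray (S : Finset (ℤ × ℤ)) (c : ℕ) (l : ℤ × ℤ → ℕ) : Prop where
  off : ∀ p, p ∉ S → l p = 0
  le : ∀ p, l p ≤ c
  left : ∀ p ∈ S, l (p.1 - 1, p.2 - 1) ≤ l p
  right : ∀ p ∈ S, l (p.1 + 1, p.2 - 1) ≤ l p

/-- The height `l p`, or the maximal height outside `S`. -/
def cap (S : Finset (ℤ × ℤ)) (c : ℕ) (l : ℤ × ℤ → ℕ) (p : ℤ × ℤ) : ℕ := if p ∈ S then l p else c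

/-- The smallest height allowed at `p` by the other cells. -/
def lo (l : ℤ × ℤ → ℕ) (p : ℤ × ℤ) : ℕ := max (l (p.1 - 1, p.2 - 1)) (l (p.1 + 1, p.2 - 1))

/-- The largest height allowed at `p` by the other cells. -/
def hi (S : Finset (ℤ × ℤ)) (c : ℕ) (l : ℤ × ℤ → ℕ) (p : ℤ × ℤ) : ℕ :=
  min (cap S c l (p.1 - 1, p.2 + 1)) (cap S c l (p.1 + 1, p.2 + 1))

section Arrays

variable {S : Finset (ℤ × ℤ)} {c : ℕ} {l l' : ℤ × ℤ → ℕ} {s : ℤ × ℤ}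

theorem IsArray.cap_le (h : IsArray S c l) (p : ℤ × ℤ) : cap S c l p ≤ c := by
  unfold cap
  split_ifs
  · exact h.le p
  · exact le_rfl

theorem IsArray.lo_le (h : IsArray S c l) (hs : s ∈ S) : lo l s ≤ l s :=
  max_le (h.left s hs) (h.right s hs)

theorem IsArray.le_hi (h : IsArray S c l) (s : ℤ × ℤ) : l s ≤ hi S c l s := by
  unfold hi cap
  refine le_min ?_ ?_
  · split_ifs with h1
    · simpa using h.right _ h1
    · exact h.le s
  · split_ifs with h1
    · simpa using h.left _ h1
    · exact h.le s

theorem lo_update (v : ℕ) : lo (Function.update l s v) s = lo l s := by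
  unfold lo
  rw [Function.update_of_ne, Function.update_of_ne] <;>
  · intro h
    have := congrArg Prod.snd h
    simp at this

theorem cap_update_of_ne {p : ℤ × ℤ} (h : p ≠ s) (v : ℕ) :
    cap S c (Function.update l s v) p = cap S c l p := by
  unfold cap
  rw [Function.update_of_ne h]

theorem hi_update (v : ℕ) : hi S c (Function.update l s v) s = hi S c l s := by
  unfold hi
  rw [cap_update_of_ne, cap_update_of_ne] <;>
  · intro h
    have := congrArg Prod.snd h
    simp at this

theorem lo_mono (h : l ≤ l') (s : ℤ × ℤ) : lo l s ≤ lo l' s := max_le_max (h _) (h _)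

theorem cap_mono (h : l ≤ l') (p : ℤ × ℤ) : cap S c l p ≤ cap S c l' p := by
  unfold cap
  split_ifs
  · exact h p
  · exact le_rfl

theorem hi_mono (h : l ≤ l') (s : ℤ × ℤ) : hi S c l s ≤ hi S c l' s :=
  min_le_min (cap_mono h _) (cap_mono h _)

/-- A weighted family of arrays, closed under the allowed unit moves, whose weight is multiplied
by `q` when a height is increased by one. -/
structure IsFamily (S : Finset (ℤ × ℤ)) (c : ℕ) (X : Finset (ℤ × ℤ → ℕ)) (w : (ℤ × ℤ → ℕ) → ℝ)
    (q : ℝ) : Prop where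
  isArray : ∀ l ∈ X, IsArray S c l
  up : ∀ l ∈ X, ∀ s ∈ S, l s < hi S c l s → Function.update l s (l s + 1) ∈ X
  down : ∀ l ∈ X, ∀ s ∈ S, lo l s < l s → Function.update l s (l s - 1) ∈ X
  pos : ∀ l ∈ X, 0 < w l
  weight_up : ∀ l ∈ X, ∀ s ∈ S, l s < hi S c l s → w (Function.update l s (l s + 1)) = q * w l

variable {X : Finset (ℤ × ℤ → ℕ)} {w : (ℤ × ℤ → ℕ) → ℝ} {q : ℝ}

theorem IsFamily.update_mem (F : IsFamily S c X w q) (hl : l ∈ X) (hs : s ∈ S) {v : ℕ}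
    (h1 : lo l s ≤ v) (h2 : v ≤ hi S c l s) : Function.update l s v ∈ X := by
  rcases le_total (l s) v with h | h
  · induction v, h using Nat.le_induction with
    | base => simpa using hl
    | succ v hv ih =>
      have h3 := F.up _ (ih (((F.isArray l hl).lo_le hs).trans hv) (by omega)) s hs
      rw [hi_update, Function.update_self, Function.update_idem] at h3
      exact h3 h2
  · obtain ⟨d, hd⟩ := Nat.exists_eq_add_of_le h
    induction d generalizing v with
    | zero =>
      have : v = l s := by omega
      simpa [this] using hl
    | succ d ih =>
      have h0 := (F.isArray l hl).le_hi s
      have h3 := F.down _ (ih (v := v + 1) (by omega) (by omega) (by omega) (by omega)) s hs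
      rw [lo_update, Function.update_self, Function.update_idem] at h3
      exact h3 (by omega)

theorem IsFamily.lo_le_hi (F : IsFamily S c X w q) (hl : l ∈ X) (hs : s ∈ S) :
    lo l s ≤ hi S c l s :=
  ((F.isArray l hl).lo_le hs).trans ((F.isArray l hl).le_hi s)

/-- On the set of arrays that agree off `s`, the weight is geometric in the height at `s`. -/
theorem IsFamily.exists_weight_update (F : IsFamily S c X w q) (hq : 0 < q) (hl : l ∈ X)
    (hs : s ∈ S) :
    ∃ C : ℝ, 0 < C ∧ ∀ v ∈ Finset.Icc (lo l s) (hi S c l s),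
      w (Function.update l s v) = C * q ^ v := by
  have hlo := F.update_mem hl hs le_rfl (F.lo_le_hi hl hs)
  refine ⟨w (Function.update l s (lo l s)) / q ^ lo l s, div_pos (F.pos _ hlo) (pow_pos hq _), ?_⟩
  intro v hv
  obtain ⟨h1, h2⟩ := Finset.mem_Icc.1 hv
  clear hv
  induction v, h1 using Nat.le_induction with
  | base => field_simp
  | succ v hv ih =>
    have h3 := F.weight_up _ (F.update_mem hl hs hv (by omega)) s hs
    rw [hi_update, Function.update_self, Function.update_idem] at h3
    rw [h3 (by omega), ih (by omega)]
    ring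

theorem IsFamily.filter_eq_image (F : IsFamily S c X w q) (hl : l ∈ X) (hs : s ∈ S) :
    X.filter (fun l' => Function.update l' s 0 = Function.update l s 0) =
      (Finset.Icc (lo l s) (hi S c l s)).image fun v => Function.update l s v := by
  ext l'
  simp only [Finset.mem_filter, Finset.mem_image, Finset.mem_Icc]
  constructor
  · rintro ⟨h1, h2⟩
    have h3 : Function.update l s (l' s) = l' := by
      rw [← Function.update_idem (0 : ℕ) (l' s) l, ← h2, Function.update_idem,
        Function.update_eq_self]
    have h4 := (F.isArray l' h1).lo_le hs
    have h5 := (F.isArray l' h1).le_hi s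
    rw [← h3, lo_update, Function.update_self] at h4
    rw [← h3, hi_update, Function.update_self] at h5
    exact ⟨l' s, ⟨h4, h5⟩, h3⟩
  · rintro ⟨v, ⟨h1, h2⟩, rfl⟩
    exact ⟨F.update_mem hl hs h1 h2, by rw [Function.update_idem]⟩

/-- The heat-bath average at the cell `s`. -/
def heatBath (X : Finset (ℤ × ℤ → ℕ)) (w : (ℤ × ℤ → ℕ) → ℝ) (s : ℤ × ℤ)
    (f : (ℤ × ℤ → ℕ) → ℝ) : (ℤ × ℤ → ℕ) → ℝ :=
  condAvg X w (fun l => Function.update l s 0) f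

theorem IsFamily.heatBath_eq (F : IsFamily S c X w q) (hq : 0 < q) (hl : l ∈ X) (hs : s ∈ S)
    (f : (ℤ × ℤ → ℕ) → ℝ) :
    heatBath X w s f l =
      (∑ v ∈ Finset.Icc (lo l s) (hi S c l s), q ^ v * f (Function.update l s v)) /
        ∑ v ∈ Finset.Icc (lo l s) (hi S c l s), q ^ v := by
  obtain ⟨C, hC, h⟩ := F.exists_weight_update hq hl hs
  unfold heatBath condAvg
  have hinj : Set.InjOn (fun v => Function.update l s v)
      (Finset.Icc (lo l s) (hi S c l s) : Set ℕ) :=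
    (Function.update_injective l s).injOn
  rw [F.filter_eq_image hl hs, Finset.sum_image hinj, Finset.sum_image hinj,
    Finset.sum_congr rfl h, ← Finset.mul_sum]
  have h2 : ∑ v ∈ Finset.Icc (lo l s) (hi S c l s),
      w (Function.update l s v) * f (Function.update l s v) =
      C * ∑ v ∈ Finset.Icc (lo l s) (hi S c l s), q ^ v * f (Function.update l s v) := by
    rw [Finset.mul_sum]
    refine Finset.sum_congr rfl fun v hv => ?_
    rw [h v hv, mul_assoc]
  rw [h2, mul_div_mul_left _ _ hC.ne']

theorem geometric_sum_pos (hq : 0 < q) {A B : ℕ} (h : A ≤ B) :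
    0 < ∑ v ∈ Finset.Icc A B, q ^ v :=
  Finset.sum_pos (fun v _ => pow_pos hq v) (Finset.nonempty_Icc.2 h)

/-- Truncated geometric laws are stochastically increasing in the truncation interval. -/
theorem geometric_average_le (hq : 0 < q) {A B A' B' : ℕ} (hA : A ≤ A') (hB : B ≤ B')
    (hAB : A ≤ B) (hAB' : A' ≤ B') {g g' : ℕ → ℝ}
    (h : ∀ v ∈ Finset.Icc A B, ∀ v' ∈ Finset.Icc A' B', v ≤ v' → g' v' ≤ g v) :
    (∑ v ∈ Finset.Icc A' B', q ^ v * g' v) / ∑ v ∈ Finset.Icc A' B', q ^ v ≤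
      (∑ v ∈ Finset.Icc A B, q ^ v * g v) / ∑ v ∈ Finset.Icc A B, q ^ v := by
  rw [div_le_div_iff₀ (geometric_sum_pos hq hAB') (geometric_sum_pos hq hAB), ← sub_nonneg,
    Finset.sum_mul_sum, Finset.sum_mul_sum, Finset.sum_comm (s := Finset.Icc A' B'),
    ← Finset.sum_sub_distrib]
  simp only [← Finset.sum_sub_distrib]
  set T := Finset.Icc A B ×ˢ Finset.Icc A' B' with hT
  set H : ℕ × ℕ → ℝ := fun p => q ^ p.1 * g p.1 * q ^ p.2 - q ^ p.2 * g' p.2 * q ^ p.1 with hH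
  have e : ∑ v ∈ Finset.Icc A B, ∑ v' ∈ Finset.Icc A' B',
      (q ^ v * g v * q ^ v' - q ^ v' * g' v' * q ^ v) = ∑ p ∈ T, H p := by
    rw [hT, Finset.sum_product]
  rw [e]
  have hHle : ∀ p ∈ T, p.1 ≤ p.2 → 0 ≤ H p := by
    intro p hp hle
    obtain ⟨h1, h2⟩ := Finset.mem_product.1 hp
    have h3 := h _ h1 _ h2 hle
    have : H p = q ^ p.1 * q ^ p.2 * (g p.1 - g' p.2) := by simp only [hH]; ring
    rw [this]
    exact mul_nonneg (by positivity) (sub_nonneg.2 h3)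
  -- Only pairs with v' < v can contribute negatively. Their swaps still lie in T because A ≤ A' ≤
  -- v' < v ≤ B ≤ B', and a pair together with its swap contributes a positive multiple of (g v - g'
  -- v) + (g v' - g' v'), which is nonnegative.
  set D := T.filter fun p => p.2 < p.1 with hD
  have hswap : ∀ p ∈ D, p.swap ∈ T ∧ p.swap.1 < p.swap.2 := by
    intro p hp
    simp only [hD, hT, Finset.mem_filter, Finset.mem_product, Finset.mem_Icc, Prod.fst_swap,
      Prod.snd_swap] at hp ⊢
    omega
  have hsub : D.image Prod.swap ⊆ T.filter fun p => ¬ p.2 < p.1 := by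
    intro p hp
    obtain ⟨p', hp', rfl⟩ := Finset.mem_image.1 hp
    exact Finset.mem_filter.2 ⟨(hswap p' hp').1, not_lt.2 (hswap p' hp').2.le⟩
  rw [← Finset.sum_filter_add_sum_filter_not T (fun p => p.2 < p.1)]
  have h1 : ∑ p ∈ D.image Prod.swap, H p ≤ ∑ p ∈ T.filter fun p => ¬ p.2 < p.1, H p :=
    Finset.sum_le_sum_of_subset_of_nonneg hsub fun p hp _ =>
      hHle p (Finset.mem_filter.1 hp).1 (not_lt.1 (Finset.mem_filter.1 hp).2)
  rw [Finset.sum_image Prod.swap_injective.injOn] at h1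
  have h2 : 0 ≤ ∑ p ∈ D, (H p + H p.swap) := by
    refine Finset.sum_nonneg fun p hp => ?_
    have hs := hswap p hp
    have hp' := Finset.mem_filter.1 hp
    obtain ⟨a1, a2⟩ := Finset.mem_product.1 hp'.1
    obtain ⟨b1, b2⟩ := Finset.mem_product.1 hs.1
    have c1 := h _ a1 _ b2 le_rfl
    have c2 := h _ b1 _ a2 le_rfl
    simp only [Prod.fst_swap, Prod.snd_swap] at c1 c2
    have : H p + H p.swap = q ^ p.1 * q ^ p.2 * ((g p.1 - g' p.1) + (g p.2 - g' p.2)) := by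
      simp only [hH, Prod.fst_swap, Prod.snd_swap]
      ring
    rw [this]
    exact mul_nonneg (by positivity) (by linarith)
  rw [Finset.sum_add_distrib] at h2
  linarith

/-- Attractiveness of the heat-bath update. -/
theorem IsFamily.antitoneOn_heatBath (F : IsFamily S c X w q) (hq : 0 < q) (hs : s ∈ S)
    {f : (ℤ × ℤ → ℕ) → ℝ} (hf : AntitoneOn f (X : Set (ℤ × ℤ → ℕ))) :
    AntitoneOn (heatBath X w s f) (X : Set (ℤ × ℤ → ℕ)) := by
  intro l hl l' hl' hle
  rw [F.heatBath_eq hq hl hs, F.heatBath_eq hq hl' hs]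
  refine geometric_average_le hq (lo_mono hle s) (hi_mono hle s) (F.lo_le_hi hl hs)
    (F.lo_le_hi hl' hs) fun v hv v' hv' hvv => ?_
  rw [Finset.mem_Icc] at hv hv'
  exact hf (F.update_mem hl hs hv.1 hv.2) (F.update_mem hl' hs hv'.1 hv'.2)
    (update_le_update_iff.2 ⟨hvv, fun p _ => hle p⟩)

/-- For q ≠ 1 this is the factorization q^(2A) - q^(2B+2) = (q^A - q^(B+1)) (q^A + q^(B+1)); the
induction covers q = 1 as well. The result is a sum of separate functions of A and B, which makes
the drift of the potential computable. -/
theorem geometric_sum_sq (hq : 0 < q) {A B : ℕ} (h : A ≤ B) :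
    (∑ v ∈ Finset.Icc A B, q ^ v * q ^ v) / ∑ v ∈ Finset.Icc A B, q ^ v =
      (q ^ A + q * q ^ B) / (1 + q) := by
  rw [div_eq_div_iff (geometric_sum_pos hq h).ne' (by positivity)]
  induction B, h using Nat.le_induction with
  | base => simp; ring
  | succ B hB ih =>
    have hg : (∑ v ∈ Finset.Icc A B, q ^ v) * (1 - q) = q ^ A - q ^ (B + 1) := by
      clear ih
      induction B, hB using Nat.le_induction with
      | base => simp; ring
      | succ B hB ih =>
        rw [← Finset.insert_Icc_right_eq_Icc_add_one (by omega), Finset.sum_insert (by simp),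
          add_mul, ih]
        ring
    rw [← Finset.insert_Icc_right_eq_Icc_add_one (by omega), Finset.sum_insert (by simp),
      Finset.sum_insert (by simp), add_mul, ih]
    linear_combination q ^ (B + 1) * hg

/-- The exponential potential. -/
def potential (S : Finset (ℤ × ℤ)) (r : ℝ) (l : ℤ × ℤ → ℕ) : ℝ :=
  ∑ p ∈ S, r ^ p.2 * (r ^ 2) ^ l p

/-- Only the term of s changes, and its exponential has the same base r^2 as the geometric law of
the new height, so `geometric_sum_sq` gives its mean. -/
theorem IsFamily.heatBath_potential {r : ℝ} (F : IsFamily S c X w (r ^ 2)) (hr : 0 < r)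
    (hl : l ∈ X) (hs : s ∈ S) :
    heatBath X w s (potential S r) l = potential S r l - r ^ s.2 * (r ^ 2) ^ l s +
      r ^ s.2 * (((r ^ 2) ^ lo l s + r ^ 2 * (r ^ 2) ^ hi S c l s) / (1 + r ^ 2)) := by
  have hq : 0 < r ^ 2 := by positivity
  have h1 : ∀ v, potential S r (Function.update l s v) =
      (potential S r l - r ^ s.2 * (r ^ 2) ^ l s) + r ^ s.2 * (r ^ 2) ^ v := by
    intro v
    unfold potential
    rw [← Finset.add_sum_erase S _ hs, ← Finset.add_sum_erase S (fun p => r ^ p.2 * (r ^ 2) ^ l p) hs,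
      Function.update_self]
    have : ∑ p ∈ S.erase s, r ^ p.2 * (r ^ 2) ^ Function.update l s v p =
        ∑ p ∈ S.erase s, r ^ p.2 * (r ^ 2) ^ l p :=
      Finset.sum_congr rfl fun p hp => by
        rw [Function.update_of_ne (Finset.ne_of_mem_erase hp)]
    rw [this]
    ring
  have hpos := geometric_sum_pos hq (F.lo_le_hi hl hs)
  rw [F.heatBath_eq hq hl hs, ← geometric_sum_sq hq (F.lo_le_hi hl hs), ← mul_div_assoc,
    eq_comm, ← eq_sub_iff_add_eq', div_eq_iff hpos.ne', sub_mul, div_mul_cancel₀ _ hpos.ne',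
    Finset.mul_sum, Finset.mul_sum, ← Finset.sum_sub_distrib]
  refine Finset.sum_congr rfl fun v _ => ?_
  rw [h1]
  ring

end Arrays

end SkewArray

end

/-! ### Drift of the potential difference between two ordered arrays. -/

noncomputable section

namespace SkewArray

open Classical

section Drift

variable {S : Finset (ℤ × ℤ)} {c : ℕ} {l l' : ℤ × ℤ → ℕ} {q : ℝ}

theorem pow_max_sub_le (hq : 0 < q) (hq1 : q ≤ 1) {a b a' b' : ℕ} (ha : a ≤ a') (hb : b ≤ b') :
    q ^ max a b - q ^ max a' b' ≤ (q ^ a - q ^ a') + (q ^ b - q ^ b') := by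
  have h1 := pow_le_pow_of_le_one hq.le hq1 ha
  have h2 := pow_le_pow_of_le_one hq.le hq1 hb
  have h3 := pow_le_pow_of_le_one hq.le hq1 (le_max_left a b)
  have h4 := pow_le_pow_of_le_one hq.le hq1 (le_max_right a b)
  rcases le_total a' b' with h | h
  · rw [max_eq_right h]
    linarith
  · rw [max_eq_left h]
    linarith

theorem pow_min_sub_le (hq : 0 < q) (hq1 : q ≤ 1) {a b a' b' : ℕ} (ha : a ≤ a') (hb : b ≤ b') :
    q ^ min a b - q ^ min a' b' ≤ (q ^ a - q ^ a') + (q ^ b - q ^ b') := by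
  have h1 := pow_le_pow_of_le_one hq.le hq1 ha
  have h2 := pow_le_pow_of_le_one hq.le hq1 hb
  have h3 := pow_le_pow_of_le_one hq.le hq1 (min_le_left a' b')
  have h4 := pow_le_pow_of_le_one hq.le hq1 (min_le_right a' b')
  rcases le_total a b with h | h
  · rw [min_eq_left h]
    linarith
  · rw [min_eq_right h]
    linarith

theorem pow_max_add_pow_min (a b : ℕ) : q ^ max a b + q ^ min a b = q ^ a + q ^ b := by
  rcases le_total a b with h | h
  · rw [max_eq_right h, min_eq_left h, add_comm]
  · rw [max_eq_left h, min_eq_right h]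

/-- A set of cells without gaps: the region between two lattice paths. -/
def Filled (S : Finset (ℤ × ℤ)) : Prop :=
  ∀ x m : ℤ, (x, m + 1) ∈ S → (x, m - 1) ∈ S → (x - 1, m) ∈ S ∧ (x + 1, m) ∈ S

/-- Off S both the caps (all equal to c) and the heights (all 0) cancel in differences, so no
boundary term appears. -/
theorem pow_cap_sub (hl : IsArray S c l) (hl' : IsArray S c l') (p : ℤ × ℤ) :
    q ^ cap S c l p - q ^ cap S c l' p = q ^ l p - q ^ l' p := by
  unfold cap
  split_ifs with h
  · rfl
  · rw [hl.off p h, hl'.off p h]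
    ring

/-- The side neighbours of (x, y) enter `lo` of the cell above through a max and `hi` of the cell
below through a min. If both cells are in S, `Filled` puts the neighbours in S, and q^max + q^min =
q^a + q^b counts each neighbour once instead of twice. If only one cell is in S, a max or a min
alone is at most the sum. -/
theorem local_drift_le (hq : 0 < q) (hq1 : q ≤ 1) (hS : Filled S) (hl : IsArray S c l)
    (hl' : IsArray S c l') (hle : l ≤ l') (x y : ℤ) :
    (if (x, y + 1) ∈ S then q ^ lo l (x, y + 1) - q ^ lo l' (x, y + 1) else 0) +
      (if (x, y - 1) ∈ S then q ^ hi S c l (x, y - 1) - q ^ hi S c l' (x, y - 1) else 0) ≤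
      (q ^ l (x - 1, y) - q ^ l' (x - 1, y)) + (q ^ l (x + 1, y) - q ^ l' (x + 1, y)) := by
  have e1 := pow_le_pow_of_le_one hq.le hq1 (hle (x - 1, y))
  have e2 := pow_le_pow_of_le_one hq.le hq1 (hle (x + 1, y))
  simp only [lo, hi, add_sub_cancel_right, sub_add_cancel]
  split_ifs with h1 h2 h2
  · obtain ⟨h3, h4⟩ := hS x y h1 h2
    simp only [cap, if_pos h3, if_pos h4]
    have := pow_max_add_pow_min (q := q) (l (x - 1, y)) (l (x + 1, y))
    have := pow_max_add_pow_min (q := q) (l' (x - 1, y)) (l' (x + 1, y))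
    linarith
  · have := pow_max_sub_le hq hq1 (hle (x - 1, y)) (hle (x + 1, y))
    linarith
  · have := pow_min_sub_le hq hq1 (cap_mono (S := S) (c := c) hle (x - 1, y))
      (cap_mono (S := S) (c := c) hle (x + 1, y))
    rw [pow_cap_sub hl hl', pow_cap_sub hl hl'] at this
    linarith
  · linarith

theorem sum_comp_le_of_injective {ι : Type*} {U T : Finset ι} {e : ι → ι}
    (he : Function.Injective e) {G : ι → ℝ} (hG : ∀ i, 0 ≤ G i) (h0 : ∀ i, i ∉ T → G i = 0) :
    ∑ i ∈ U, G (e i) ≤ ∑ i ∈ T, G i := by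
  rw [← Finset.sum_image (f := G) (g := e) he.injOn,
    ← Finset.sum_filter_add_sum_filter_not (U.image e) (fun i => i ∈ T),
    Finset.sum_eq_zero (s := (U.image e).filter fun i => i ∉ T), add_zero]
  · exact Finset.sum_le_sum_of_subset_of_nonneg
      (fun i hi => (Finset.mem_filter.1 hi).2) fun i _ _ => hG i
  · exact fun i hi => h0 i (Finset.mem_filter.1 hi).2

/-- The sum is regrouped by the point p midway between the two neighbours that a cell looks at: the
lower pair of the cell above p and the upper pair of the cell below p coincide. Each cell then
serves as a left and as a right neighbour at most once, whence the factor 2. -/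
theorem drift_le {r : ℝ} (hr : 0 < r) (hr1 : r ≤ 1) (hS : Filled S) (hl : IsArray S c l)
    (hl' : IsArray S c l') (hle : l ≤ l') :
    ∑ s ∈ S, r ^ s.2 * (((r ^ 2) ^ lo l s + r ^ 2 * (r ^ 2) ^ hi S c l s) -
      ((r ^ 2) ^ lo l' s + r ^ 2 * (r ^ 2) ^ hi S c l' s)) ≤
      2 * r * (potential S r l - potential S r l') := by
  have hq : 0 < r ^ 2 := by positivity
  have hq1 : r ^ 2 ≤ 1 := pow_le_one₀ hr.le hr1
  set q := r ^ 2 with hqdef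
  set dn : ℤ × ℤ → ℤ × ℤ := fun p => (p.1, p.2 - 1) with hdn
  set up : ℤ × ℤ → ℤ × ℤ := fun p => (p.1, p.2 + 1) with hup
  have hdu : ∀ p, dn (up p) = p := fun p => by simp [hdn, hup]
  have hud : ∀ p, up (dn p) = p := fun p => by simp [hdn, hup]
  set U := S.image dn ∪ S.image up with hU
  have reindex : ∀ (d e : ℤ × ℤ → ℤ × ℤ) (_ : ∀ p, d (e p) = p) (_ : ∀ p, e (d p) = p)
      (_ : S.image d ⊆ U) (G : ℤ × ℤ → ℝ),
      ∑ s ∈ S, G s = ∑ p ∈ U, if e p ∈ S then G (e p) else 0 := by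
    intro d e h1 h2 h3 G
    have h4 : U.filter (fun p => e p ∈ S) = S.image d := by
      ext p
      simp only [Finset.mem_filter, Finset.mem_image]
      constructor
      · exact fun h => ⟨e p, h.2, h1 p⟩
      · rintro ⟨s, hs, rfl⟩
        exact ⟨h3 (Finset.mem_image_of_mem d hs), by rwa [h2]⟩
    rw [← Finset.sum_filter, h4, Finset.sum_image (Function.LeftInverse.injective h2).injOn]
    simp only [h2]
  have split : ∑ s ∈ S, r ^ s.2 * ((q ^ lo l s + q * q ^ hi S c l s) -
      (q ^ lo l' s + q * q ^ hi S c l' s)) =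
      ∑ s ∈ S, r ^ s.2 * (q ^ lo l s - q ^ lo l' s) +
      ∑ s ∈ S, r ^ s.2 * q * (q ^ hi S c l s - q ^ hi S c l' s) := by
    rw [← Finset.sum_add_distrib]
    exact Finset.sum_congr rfl fun s _ => by ring
  rw [split, reindex dn up hdu hud Finset.subset_union_left,
    reindex up dn hud hdu Finset.subset_union_right, ← Finset.sum_add_distrib]
  have hδ : ∀ p, 0 ≤ q ^ l p - q ^ l' p := fun p =>
    sub_nonneg.2 (pow_le_pow_of_le_one hq.le hq1 (hle p))
  set G : ℤ × ℤ → ℝ := fun p => r ^ (p.2 + 1) * (q ^ l p - q ^ l' p) with hG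
  have hG0 : ∀ p, 0 ≤ G p := fun p => mul_nonneg (zpow_pos hr _).le (hδ p)
  have hGS : ∀ p, p ∉ S → G p = 0 := fun p hp => by
    simp only [hG, hl.off p hp, hl'.off p hp, sub_self, mul_zero]
  calc _ ≤ ∑ p ∈ U, (G (p.1 - 1, p.2) + G (p.1 + 1, p.2)) := by
        refine Finset.sum_le_sum fun p _ => ?_
        have h1 := local_drift_le hq hq1 hS hl hl' hle p.1 p.2
        have h2 := mul_le_mul_of_nonneg_left h1 (zpow_pos hr (p.2 + 1)).le
        -- This equality of weights dictates the factor r^y in the potential: the cell above p and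
        -- the cell below p, the latter carrying the extra q, get the same coefficient.
        have h3 : r ^ (p.2 - 1) * q = r ^ (p.2 + 1) := by
          rw [hqdef, ← zpow_natCast, ← zpow_add₀ hr.ne']
          congr 1
          push_cast
          ring
        simp only [hup, hdn, hG, h3]
        rw [mul_add, mul_add, mul_ite, mul_ite, mul_zero] at h2
        exact h2
    _ ≤ ∑ p ∈ S, G p + ∑ p ∈ S, G p := by
        rw [Finset.sum_add_distrib]
        refine add_le_add (sum_comp_le_of_injective (e := fun p => (p.1 - 1, p.2)) ?_ hG0 hGS)
          (sum_comp_le_of_injective (e := fun p => (p.1 + 1, p.2)) ?_ hG0 hGS)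
        · rintro ⟨x, y⟩ ⟨x', y'⟩ h
          simpa using h
        · rintro ⟨x, y⟩ ⟨x', y'⟩ h
          simpa using h
    _ = 2 * r * (potential S r l - potential S r l') := by
        unfold potential
        rw [← Finset.sum_sub_distrib, Finset.mul_sum, ← Finset.sum_add_distrib]
        refine Finset.sum_congr rfl fun p _ => ?_
        simp only [hG, zpow_add_one₀ hr.ne']
        ring

end Drift

/-! ### Spectral gap of the resampling dynamics and Poincaré inequality for unit moves. -/

section Gap

variable {S : Finset (ℤ × ℤ)} {c : ℕ} {X : Finset (ℤ × ℤ → ℕ)} {w : (ℤ × ℤ → ℕ) → ℝ} {r : ℝ}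

/-- A member of least total height vanishes: otherwise a lowest cell of nonzero height, whose lower
neighbours have height 0, could be decreased. The zero array is the least element through which any
two arrays get compared. -/
theorem IsFamily.zero_mem {q : ℝ} (F : IsFamily S c X w q) (hX : X.Nonempty) :
    (0 : ℤ × ℤ → ℕ) ∈ X := by
  obtain ⟨l, hl, hmin⟩ := X.exists_min_image (fun l => ∑ p ∈ S, l p) hX
  by_cases h : ∃ p ∈ S, l p ≠ 0
  · obtain ⟨p, hp, hlow⟩ := (S.filter fun p => l p ≠ 0).exists_min_image (fun p => p.2)
      (by obtain ⟨p, hp⟩ := h; exact ⟨p, Finset.mem_filter.2 hp⟩)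
    obtain ⟨hpS, hp0⟩ := Finset.mem_filter.1 hp
    have hz : ∀ p' : ℤ × ℤ, p'.2 < p.2 → l p' = 0 := by
      intro p' hlt
      by_contra h0
      have h1 : p' ∈ S := by
        by_contra h2
        exact h0 ((F.isArray l hl).off p' h2)
      exact absurd (hlow p' (Finset.mem_filter.2 ⟨h1, h0⟩)) (not_le.2 hlt)
    have hlo : lo l p = 0 := by
      unfold lo
      rw [hz _ (by simp), hz _ (by simp), max_self]
    have h1 := hmin _ (F.down l hl p hpS (by omega))
    have h2 : ∑ p' ∈ S, Function.update l p (l p - 1) p' < ∑ p' ∈ S, l p' := by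
      refine Finset.sum_lt_sum (fun p' _ => ?_) ⟨p, hpS, ?_⟩
      · rcases eq_or_ne p' p with rfl | hne
        · simp
        · rw [Function.update_of_ne hne]
      · rw [Function.update_self]
        omega
    exact absurd h1 (not_le.2 h2)
  · push Not at h
    have : l = 0 := by
      funext p
      by_cases hp : p ∈ S
      · exact h p hp
      · exact (F.isArray l hl).off p hp
    rwa [← this]

/-- A lazy version of the discrete-time heat-bath chain. -/
def step (S : Finset (ℤ × ℤ)) (X : Finset (ℤ × ℤ → ℕ)) (w : (ℤ × ℤ → ℕ) → ℝ)
    (f : (ℤ × ℤ → ℕ) → ℝ) (l : ℤ × ℤ → ℕ) : ℝ :=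
  (f l + ∑ s ∈ S, heatBath X w s f l) / (S.card + 1)

theorem step_sum (a b : ℝ) (f g : (ℤ × ℤ → ℕ) → ℝ) (l : ℤ × ℤ → ℕ) :
    step S X w (fun l => a * f l + b * g l) l = a * step S X w f l + b * step S X w g l := by
  unfold step heatBath
  simp only [condAvg_add, condAvg_const_mul, Finset.sum_add_distrib, ← Finset.mul_sum]
  ring

theorem IsFamily.antitoneOn_step {q : ℝ} (F : IsFamily S c X w q) (hq : 0 < q)
    {f : (ℤ × ℤ → ℕ) → ℝ} (hf : AntitoneOn f (X : Set (ℤ × ℤ → ℕ))) :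
    AntitoneOn (step S X w f) (X : Set (ℤ × ℤ → ℕ)) := by
  intro l hl l' hl' hle
  unfold step
  have h1 := hf hl hl' hle
  have h2 : ∑ s ∈ S, heatBath X w s f l' ≤ ∑ s ∈ S, heatBath X w s f l :=
    Finset.sum_le_sum fun s hs => F.antitoneOn_heatBath hq hs hf hl hl' hle
  gcongr

/-- The contraction rate of one step. -/
def rate (S : Finset (ℤ × ℤ)) (r : ℝ) : ℝ := (S.card + 2 * r / (1 + r ^ 2)) / (S.card + 1)

/-- This is `drift_le` averaged over the cells. -/
theorem IsFamily.step_potential_le (F : IsFamily S c X w (r ^ 2)) (hr : 0 < r) (hr1 : r ≤ 1)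
    (hS : Filled S) {l l' : ℤ × ℤ → ℕ} (hl : l ∈ X) (hl' : l' ∈ X) (hle : l ≤ l') :
    step S X w (potential S r) l - step S X w (potential S r) l' ≤
      rate S r * (potential S r l - potential S r l') := by
  have h := drift_le hr hr1 hS (F.isArray l hl) (F.isArray l' hl') hle
  -- The removed terms add up to one full potential, which the lazy summand of `step` restores.
  have e : ∀ l ∈ X, ∑ s ∈ S, heatBath X w s (potential S r) l =
      S.card * potential S r l - potential S r l +
      (∑ s ∈ S, r ^ s.2 * ((r ^ 2) ^ lo l s + r ^ 2 * (r ^ 2) ^ hi S c l s)) / (1 + r ^ 2) := by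
    intro l hl
    rw [Finset.sum_congr rfl fun s hs => F.heatBath_potential hr hl hs, Finset.sum_add_distrib,
      Finset.sum_sub_distrib, Finset.sum_const, nsmul_eq_mul, Finset.sum_div]
    simp only [mul_div_assoc]
    rfl
  have hN : (0 : ℝ) < S.card + 1 := by positivity
  have hq : (0 : ℝ) < 1 + r ^ 2 := by positivity
  unfold step rate
  rw [e l hl, e l' hl', ← sub_div, div_mul_eq_mul_div, div_le_div_iff_of_pos_right hN]
  simp only [mul_sub, Finset.sum_sub_distrib] at h
  have h' := div_le_div_of_nonneg_right h hq.le
  rw [sub_div] at h'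
  have e2 : (2 * r * potential S r l - 2 * r * potential S r l') / (1 + r ^ 2) =
    2 * r / (1 + r ^ 2) * potential S r l - 2 * r / (1 + r ^ 2) * potential S r l' := by ring
  rw [e2] at h'
  linarith

/-- The Lipschitz bound says that K V + f and K V - f are both antitone. One step is linear and
preserves antitone functions, so only the contraction of V is needed, and no coupling. -/
theorem IsFamily.abs_step_sub_le (F : IsFamily S c X w (r ^ 2)) (hr : 0 < r) (hr1 : r ≤ 1)
    (hS : Filled S) {f : (ℤ × ℤ → ℕ) → ℝ} {K : ℝ} (hK : 0 ≤ K)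
    (hf : ∀ l ∈ X, ∀ l' ∈ X, l ≤ l' → |f l - f l'| ≤ K * (potential S r l - potential S r l')) :
    ∀ l ∈ X, ∀ l' ∈ X, l ≤ l' → |step S X w f l - step S X w f l'| ≤
      K * rate S r * (potential S r l - potential S r l') := by
  intro l hl l' hl' hle
  have key : ∀ b : ℝ, |b| = 1 → b * (step S X w f l' - step S X w f l) ≤
      K * rate S r * (potential S r l - potential S r l') := by
    intro b hb
    have h1 : AntitoneOn (fun l => K * potential S r l + b * f l) (X : Set (ℤ × ℤ → ℕ)) := by
      intro l hl l' hl' hle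
      have h2 := (le_abs_self (b * (f l' - f l)))
      rw [abs_mul, hb, one_mul, abs_sub_comm] at h2
      have h3 := hf l hl l' hl' hle
      simp only
      linarith
    have h2 := F.antitoneOn_step (by positivity) h1 hl hl' hle
    rw [step_sum, step_sum] at h2
    have h3 := mul_le_mul_of_nonneg_left (F.step_potential_le hr hr1 hS hl hl' hle) hK
    linarith
  rw [abs_sub_le_iff]
  constructor
  · linarith [key (-1) (by simp)]
  · linarith [key 1 (by simp)]

theorem IsFamily.exists_lipschitz (F : IsFamily S c X w (r ^ 2)) (hr : 0 < r) (hr1 : r < 1)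
    (f : (ℤ × ℤ → ℕ) → ℝ) :
    ∃ K : ℝ, 0 ≤ K ∧ ∀ l ∈ X, ∀ l' ∈ X, l ≤ l' →
      |f l - f l'| ≤ K * (potential S r l - potential S r l') := by
  have hq : 0 < r ^ 2 := by positivity
  have hq1 : r ^ 2 < 1 := pow_lt_one₀ hr.le hr1 (by norm_num)
  -- V is strictly decreasing and X is finite, so the sum of all ratios is a valid constant; pairs
  -- of equal potential contribute 0 through division by zero.
  refine ⟨∑ p ∈ X ×ˢ X, |f p.1 - f p.2| / |potential S r p.1 - potential S r p.2|,
    Finset.sum_nonneg fun _ _ => by positivity, fun l hl l' hl' hle => ?_⟩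
  by_cases heq : l = l'
  · subst heq
    simp
  have hlt : potential S r l' < potential S r l := by
    obtain ⟨p, hp⟩ := Function.ne_iff.1 heq
    have hpS : p ∈ S := by
      by_contra h
      rw [(F.isArray l hl).off p h, (F.isArray l' hl').off p h] at hp
      exact hp rfl
    refine Finset.sum_lt_sum (fun p _ => ?_) ⟨p, hpS, ?_⟩
    · exact mul_le_mul_of_nonneg_left (pow_le_pow_of_le_one hq.le hq1.le (hle p))
        (zpow_pos hr _).le
    · exact mul_lt_mul_of_pos_left (pow_lt_pow_right_of_lt_one₀ hq hq1
        (lt_of_le_of_ne (hle p) hp)) (zpow_pos hr _)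
  have hpos := sub_pos.2 hlt
  have h1 : |f l - f l'| / |potential S r l - potential S r l'| ≤
      ∑ p ∈ X ×ˢ X, |f p.1 - f p.2| / |potential S r p.1 - potential S r p.2| :=
    Finset.single_le_sum (f := fun p : (ℤ × ℤ → ℕ) × (ℤ × ℤ → ℕ) =>
      |f p.1 - f p.2| / |potential S r p.1 - potential S r p.2|)
      (fun _ _ => by positivity) (Finset.mk_mem_product hl hl')
  rw [abs_of_pos hpos, div_le_iff₀ hpos] at h1
  exact h1

theorem rate_pos (hr : 0 < r) : 0 < rate S r := by
  unfold rate
  positivity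

/-- Spectral gap of the heat-bath dynamics. -/
theorem IsFamily.heatBath_gap (F : IsFamily S c X w (r ^ 2)) (hr : 0 < r) (hr1 : r < 1)
    (hS : Filled S) (hw1 : ∑ l ∈ X, w l = 1) {f : (ℤ × ℤ → ℕ) → ℝ}
    (hf : ∑ l ∈ X, w l * f l = 0) :
    (1 - 2 * r / (1 + r ^ 2)) * ∑ l ∈ X, w l * f l ^ 2 ≤
      ∑ s ∈ S, ∑ l ∈ X, w l * f l * (f l - heatBath X w s f l) := by
  have hN : (0 : ℝ) < S.card + 1 := by positivity
  have expand : ∀ f g : (ℤ × ℤ → ℕ) → ℝ, ∑ l ∈ X, w l * f l * step S X w g l =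
      (∑ l ∈ X, w l * f l * g l + ∑ s ∈ S, ∑ l ∈ X, w l * f l * heatBath X w s g l) /
        (S.card + 1) := by
    intro f g
    rw [Finset.sum_comm, ← Finset.sum_add_distrib, Finset.sum_div]
    refine Finset.sum_congr rfl fun l _ => ?_
    unfold step
    rw [← Finset.mul_sum]
    ring
  have hsym : ∀ f g : (ℤ × ℤ → ℕ) → ℝ, ∑ l ∈ X, w l * step S X w f l * g l =
      ∑ l ∈ X, w l * f l * step S X w g l := by
    intro f g
    have h1 : ∑ l ∈ X, w l * step S X w f l * g l = ∑ l ∈ X, w l * g l * step S X w f l :=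
      Finset.sum_congr rfl fun l _ => by ring
    rw [h1, expand, expand]
    congr 2
    · exact Finset.sum_congr rfl fun l _ => by ring
    · refine Finset.sum_congr rfl fun s _ => ?_
      unfold heatBath
      rw [← sum_condAvg_mul]
      exact Finset.sum_congr rfl fun l _ => by ring
  have hone : ∀ l ∈ X, step S X w (fun _ => 1) l = 1 := by
    intro l hl
    unfold step heatBath
    rw [Finset.sum_congr rfl fun s _ =>
      condAvg_of_invariant (f := fun _ => (1 : ℝ)) F.pos (fun _ _ _ _ _ => rfl) hl]
    simp only [Finset.sum_const, nsmul_eq_mul, mul_one]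
    rw [add_comm, div_self hN.ne']
  have hmean : ∀ f : (ℤ × ℤ → ℕ) → ℝ, ∑ l ∈ X, w l * step S X w f l = ∑ l ∈ X, w l * f l := by
    intro f
    have h := hsym f (fun _ => 1)
    simp only [mul_one] at h
    rw [h]
    exact Finset.sum_congr rfl fun l hl => by rw [hone l hl, mul_one]
  obtain ⟨K, hK, hLip⟩ := F.exists_lipschitz hr hr1 f
  have hR := rate_pos (S := S) hr
  have hiter : ∀ n, ∀ l ∈ X, ∀ l' ∈ X, l ≤ l' → |((step S X w)^[n] f) l -
      ((step S X w)^[n] f) l'| ≤ K * rate S r ^ n * (potential S r l - potential S r l') := by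
    intro n
    induction n with
    | zero => simpa using hLip
    | succ n ih =>
      intro l hl l' hl' hle
      rw [Function.iterate_succ_apply', pow_succ, ← mul_assoc]
      exact F.abs_step_sub_le hr hr1.le hS (by positivity) ih l hl l' hl' hle
  have hVpos : ∀ l, 0 ≤ potential S r l := fun l =>
    Finset.sum_nonneg fun p _ => mul_nonneg (zpow_pos hr _).le (by positivity)
  have hosc : ∀ n, ∀ l ∈ X, ∀ l' ∈ X, |((step S X w)^[n] f) l - ((step S X w)^[n] f) l'| ≤
      2 * K * potential S r 0 * rate S r ^ n := by
    intro n l hl l' hl'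
    -- Incomparable arrays are compared through the zero array, at the cost of a factor 2 that does
    -- not affect the rate.
    have h0 := F.zero_mem ⟨l, hl⟩
    have hbound : ∀ l ∈ X, |((step S X w)^[n] f) 0 - ((step S X w)^[n] f) l| ≤
        K * rate S r ^ n * potential S r 0 := fun l hl =>
      (hiter n 0 h0 l hl fun p => Nat.zero_le _).trans
        (mul_le_mul_of_nonneg_left (by linarith [hVpos l]) (by positivity))
    have h1 := hbound l hl
    have h2 := hbound l' hl'
    rw [abs_le] at h1 h2 ⊢
    constructor <;> linarith [h1.1, h1.2, h2.1, h2.2]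
  have main := quadratic_form_le_of_contraction F.pos hw1 hsym hmean hR hf hosc
  -- Multiplying by card S + 1 turns the discrete-time bound into one for rate-one clocks, and the
  -- dependence on the size of S cancels.
  rw [expand, div_le_iff₀ hN] at main
  have e1 : ∑ s ∈ S, ∑ l ∈ X, w l * f l * (f l - heatBath X w s f l) =
      S.card * ∑ l ∈ X, w l * f l ^ 2 -
        ∑ s ∈ S, ∑ l ∈ X, w l * f l * heatBath X w s f l := by
    rw [← nsmul_eq_mul, ← Finset.sum_const, ← Finset.sum_sub_distrib]
    refine Finset.sum_congr rfl fun s _ => ?_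
    rw [← Finset.sum_sub_distrib]
    exact Finset.sum_congr rfl fun l _ => by ring
  have e2 : ∑ l ∈ X, w l * f l * f l = ∑ l ∈ X, w l * f l ^ 2 :=
    Finset.sum_congr rfl fun l _ => by ring
  have e3 : rate S r * (∑ l ∈ X, w l * f l ^ 2) * (S.card + 1) =
      (S.card + 2 * r / (1 + r ^ 2)) * ∑ l ∈ X, w l * f l ^ 2 := by
    unfold rate
    field_simp
  rw [e1]
  rw [e2, e3] at main
  linarith

/-- A Hardy inequality: the heat-bath Dirichlet form is controlled by unit moves. -/
theorem IsFamily.heatBath_form_le {q : ℝ} (F : IsFamily S c X w q) (hq : 0 < q) (hq1 : q < 1)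
    {s : ℤ × ℤ} (hs : s ∈ S) (f : (ℤ × ℤ → ℕ) → ℝ) :
    ∑ l ∈ X, w l * f l * (f l - heatBath X w s f l) ≤ 2 * q * (1 + q) / (1 - q) ^ 2 *
      ∑ l ∈ X.filter (fun l => l s < hi S c l s),
        w l * (f (Function.update l s (l s + 1)) - f l) ^ 2 := by
  set b : (ℤ × ℤ → ℕ) → ℝ := fun l => f (Function.update l s (lo l s)) with hb
  have hinv : ∀ l v, b (Function.update l s v) = b l := by
    intro l v
    simp only [hb, lo_update, Function.update_idem]
  refine (sum_mul_sub_condAvg_le F.pos f b ?_).trans ?_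
  · intro l _ l' _ h
    rw [← hinv l 0, ← h, hinv l' 0]
  set A := ∑ l ∈ X, w l * (f l - b l) ^ 2 with hA
  set Y := X.filter (fun l => l s < hi S c l s) with hY
  set D := ∑ l ∈ Y, w l * (f (Function.update l s (l s + 1)) - f l) ^ 2 with hD
  -- Terms at the bottom of their column vanish. The others are shifted down by one, which brings
  -- out a factor q.
  have hA1 : A = ∑ l ∈ Y, q * w l * (f (Function.update l s (l s + 1)) - b l) ^ 2 := by
    have h1 : A = ∑ l ∈ X.filter (fun l => lo l s < l s), w l * (f l - b l) ^ 2 := by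
      rw [hA, Finset.sum_filter_of_ne]
      intro l hl hne
      refine lt_of_le_of_ne ((F.isArray l hl).lo_le hs) fun heq => hne ?_
      simp only [hb, heq, Function.update_eq_self]
      ring
    rw [h1]
    refine Finset.sum_nbij' (fun l => Function.update l s (l s - 1))
      (fun l => Function.update l s (l s + 1)) ?_ ?_ ?_ ?_ ?_
    · intro l hl
      obtain ⟨hl1, hl2⟩ := Finset.mem_filter.1 hl
      refine Finset.mem_filter.2 ⟨F.down l hl1 s hs hl2, ?_⟩
      rw [hi_update, Function.update_self]
      have := (F.isArray l hl1).le_hi s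
      omega
    · intro l hl
      obtain ⟨hl1, hl2⟩ := Finset.mem_filter.1 hl
      refine Finset.mem_filter.2 ⟨F.up l hl1 s hs hl2, ?_⟩
      rw [lo_update, Function.update_self]
      have := (F.isArray l hl1).lo_le hs
      omega
    · intro l hl
      have hl2 := (Finset.mem_filter.1 hl).2
      rw [Function.update_self, Function.update_idem, Nat.sub_add_cancel (by omega),
        Function.update_eq_self]
    · intro l hl
      rw [Function.update_self, Function.update_idem, Nat.add_sub_cancel, Function.update_eq_self]
    · intro l hl
      obtain ⟨hl1, hl2⟩ := Finset.mem_filter.1 hl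
      have h2 := F.weight_up _ (F.down l hl1 s hs hl2) s hs
      rw [hi_update, Function.update_self, Function.update_idem, Nat.sub_add_cancel (by omega),
        Function.update_eq_self] at h2
      have := (F.isArray l hl1).le_hi s
      rw [h2 (by omega), hinv, Function.update_self, Function.update_idem,
        Nat.sub_add_cancel (by omega), Function.update_eq_self]
  have hq2 : 0 < 1 - q := by linarith
  -- Young's inequality for q (a + d)^2, tuned so that the coefficient of a^2 is (1 + q)/2, strictly
  -- between q and 1; the term in A can then be absorbed on the left.
  have hA2 : A ≤ (1 + q) / 2 * A + q * (1 + q) / (1 - q) * D := by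
    have h1 : ∀ l ∈ Y, q * w l * (f (Function.update l s (l s + 1)) - b l) ^ 2 ≤
        (1 + q) / 2 * (w l * (f l - b l) ^ 2) +
        q * (1 + q) / (1 - q) * (w l * (f (Function.update l s (l s + 1)) - f l) ^ 2) := by
      intro l hl
      have hwl := F.pos l (Finset.mem_filter.1 hl).1
      set a := f l - b l
      set d := f (Function.update l s (l s + 1)) - f l
      have e : f (Function.update l s (l s + 1)) - b l = a + d := by ring
      rw [e]
      have h2 : (1 + q) / 2 * a ^ 2 + q * (1 + q) / (1 - q) * d ^ 2 - q * (a + d) ^ 2 =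
          ((1 - q) * a - 2 * q * d) ^ 2 / (2 * (1 - q)) := by
        field_simp
        ring
      have h3 : 0 ≤ ((1 - q) * a - 2 * q * d) ^ 2 / (2 * (1 - q)) := by positivity
      have h4 : q * (a + d) ^ 2 ≤ (1 + q) / 2 * a ^ 2 + q * (1 + q) / (1 - q) * d ^ 2 := by
        linarith
      have h5 := mul_le_mul_of_nonneg_left h4 hwl.le
      linarith
    have h2 := Finset.sum_le_sum h1
    rw [← hA1, Finset.sum_add_distrib, ← Finset.mul_sum, ← Finset.mul_sum] at h2
    have h3 : ∑ l ∈ Y, w l * (f l - b l) ^ 2 ≤ A :=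
      Finset.sum_le_sum_of_subset_of_nonneg (Finset.filter_subset _ _) fun l hl _ =>
        mul_nonneg (F.pos l hl).le (sq_nonneg _)
    have h4 := mul_le_mul_of_nonneg_left h3 (show 0 ≤ (1 + q) / 2 by positivity)
    linarith
  have e : 2 * q * (1 + q) / (1 - q) ^ 2 * D = 2 / (1 - q) * (q * (1 + q) / (1 - q) * D) := by
    field_simp
  rw [e, div_mul_eq_mul_div, le_div_iff₀ hq2]
  linarith

/-- The Poincaré constant of the unit-move dynamics. -/
def poincareConst (r : ℝ) : ℝ :=
  2 * r ^ 2 * (1 + r ^ 2) / (1 - r ^ 2) ^ 2 / (1 - 2 * r / (1 + r ^ 2))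

/-- The quantity equals (1 - r)^2 / (1 + r^2). -/
theorem one_sub_pos (hr : 0 < r) (hr1 : r < 1) : 0 < 1 - 2 * r / (1 + r ^ 2) := by
  rw [sub_pos, div_lt_one (by positivity)]
  nlinarith [sq_pos_of_pos (sub_pos.2 hr1)]

theorem poincareConst_pos (hr : 0 < r) (hr1 : r < 1) : 0 < poincareConst r := by
  have h1 := one_sub_pos hr hr1
  have h2 : 0 < 1 - r ^ 2 := sub_pos.2 (pow_lt_one₀ hr.le hr1 (by norm_num))
  unfold poincareConst
  positivity

/-- Poincaré inequality for the unit-move dynamics, uniform in the domain. -/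
theorem IsFamily.variance_le (F : IsFamily S c X w (r ^ 2)) (hr : 0 < r) (hr1 : r < 1)
    (hS : Filled S) (hw1 : ∑ l ∈ X, w l = 1) (f : (ℤ × ℤ → ℕ) → ℝ) :
    ∑ l ∈ X, w l * f l ^ 2 - (∑ l ∈ X, w l * f l) ^ 2 ≤ poincareConst r *
      ∑ s ∈ S, ∑ l ∈ X.filter (fun l => l s < hi S c l s),
        w l * (f (Function.update l s (l s + 1)) - f l) ^ 2 := by
  set a := ∑ l ∈ X, w l * f l with ha
  have h0 : ∑ l ∈ X, w l * (f l - a) = 0 := by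
    simp only [mul_sub, Finset.sum_sub_distrib, ← Finset.sum_mul, hw1]
    rw [← ha]
    ring
  have h1 := F.heatBath_gap hr hr1 hS hw1 h0
  have h2 : ∑ l ∈ X, w l * (f l - a) ^ 2 = ∑ l ∈ X, w l * f l ^ 2 - a ^ 2 :=
    sum_mul_sub_mean_sq hw1 f
  have hpos := one_sub_pos hr hr1
  have h3 := Finset.sum_le_sum fun s hs =>
    F.heatBath_form_le (q := r ^ 2) (by positivity) (pow_lt_one₀ hr.le hr1 (by norm_num)) hs
      (fun l => f l - a)
  simp only [sub_sub_sub_cancel_right] at h3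
  rw [← Finset.mul_sum] at h3
  rw [← h2]
  unfold poincareConst
  rw [div_mul_eq_mul_div, le_div_iff₀ hpos, mul_comm]
  exact h1.trans h3

end Gap

end SkewArray

end

/-! ### Transfer of the Poincaré inequality along an injective encoding. -/

noncomputable section

namespace SkewArray

open Classical

/-- Poincaré inequality for a system encoded injectively by arrays, with an explicit list of moves
realizing all allowed unit increments. -/
theorem variance_le_of_encoding {Ω ι : Type*} {S : Finset (ℤ × ℤ)} {c : ℕ} {Y : Finset Ω}
    {w : Ω → ℝ} {r : ℝ} (hr : 0 < r) (hr1 : r < 1) (hS : Filled S) (L : Ω → ℤ × ℤ → ℕ)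
    (J : Finset ι) (mv : ι → Ω → Ω)
    (hinj : ∀ η ∈ Y, ∀ η' ∈ Y, L η = L η' → η = η')
    (hpos : ∀ η ∈ Y, 0 < w η) (hw1 : ∑ η ∈ Y, w η = 1)
    (harr : ∀ η ∈ Y, IsArray S c (L η))
    (hup : ∀ η ∈ Y, ∀ s ∈ S, L η s < hi S c (L η) s → ∃ j ∈ J, mv j η ∈ Y ∧
      L (mv j η) = Function.update (L η) s (L η s + 1) ∧ w (mv j η) = r ^ 2 * w η)
    (hdown : ∀ η ∈ Y, ∀ s ∈ S, lo (L η) s < L η s → ∃ η' ∈ Y,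
      L η' = Function.update (L η) s (L η s - 1))
    (f : Ω → ℝ) :
    ∑ η ∈ Y, w η * f η ^ 2 - (∑ η ∈ Y, w η * f η) ^ 2 ≤ poincareConst r *
      ∑ j ∈ J, ∑ η ∈ Y.filter (fun η => mv j η ∈ Y), w η * (f (mv j η) - f η) ^ 2 := by
  rcases Y.eq_empty_or_nonempty with rfl | ⟨η₀, hη₀⟩
  · simp
  have : Nonempty Ω := ⟨η₀⟩
  -- Weights and observables are carried to arrays by this inverse of the encoding.
  set M := Function.invFunOn L (Y : Set Ω) with hM
  have hInj : Set.InjOn L (Y : Set Ω) := fun η h η' h' e => hinj η h η' h' e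
  have hML : ∀ η ∈ Y, M (L η) = η := fun η h => hInj.leftInvOn_invFunOn h
  have F : IsFamily S c (Y.image L) (fun l => w (M l)) (r ^ 2) := by
    constructor
    · intro l hl
      obtain ⟨η, h, rfl⟩ := Finset.mem_image.1 hl
      exact harr η h
    · intro l hl s hs hlt
      obtain ⟨η, h, rfl⟩ := Finset.mem_image.1 hl
      obtain ⟨j, _, h1, h2, _⟩ := hup η h s hs hlt
      exact Finset.mem_image.2 ⟨_, h1, h2⟩
    · intro l hl s hs hlt
      obtain ⟨η, h, rfl⟩ := Finset.mem_image.1 hl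
      obtain ⟨η', h1, h2⟩ := hdown η h s hs hlt
      exact Finset.mem_image.2 ⟨_, h1, h2⟩
    · intro l hl
      obtain ⟨η, h, rfl⟩ := Finset.mem_image.1 hl
      simp only [hML η h]
      exact hpos η h
    · intro l hl s hs hlt
      obtain ⟨η, h, rfl⟩ := Finset.mem_image.1 hl
      obtain ⟨j, _, h1, h2, h3⟩ := hup η h s hs hlt
      simp only [← h2, hML η h, hML _ h1, h3]
  have push : ∀ G : Ω → ℝ, ∑ l ∈ Y.image L, G (M l) = ∑ η ∈ Y, G η := by
    intro G
    rw [Finset.sum_image hInj]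
    exact Finset.sum_congr rfl fun η h => by rw [hML η h]
  have main := F.variance_le hr hr1 hS ((push w).trans hw1) (fun l => f (M l))
  rw [push fun η => w η * f η ^ 2, push fun η => w η * f η] at main
  refine main.trans (mul_le_mul_of_nonneg_left ?_ (poincareConst_pos hr hr1).le)
  have e1 : ∀ s ∈ S, ∑ l ∈ (Y.image L).filter (fun l => l s < hi S c l s),
      w (M l) * (f (M (Function.update l s (l s + 1))) - f (M l)) ^ 2 =
      ∑ η ∈ Y, if L η s < hi S c (L η) s then
        w η * (f (M (Function.update (L η) s (L η s + 1))) - f η) ^ 2 else 0 := by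
    intro s _
    rw [Finset.sum_filter, Finset.sum_image hInj]
    exact Finset.sum_congr rfl fun η h => by rw [hML η h]
  rw [Finset.sum_congr rfl e1, Finset.sum_comm]
  simp only [Finset.sum_filter]
  rw [Finset.sum_comm (s := J)]
  refine Finset.sum_le_sum fun η hη => ?_
  rw [← Finset.sum_filter, ← Finset.sum_filter]
  rcases (S.filter (fun s => L η s < hi S c (L η) s)).eq_empty_or_nonempty with h0 | ⟨s₀, hs₀⟩
  · rw [h0, Finset.sum_empty]
    exact Finset.sum_nonneg fun _ _ => mul_nonneg (hpos η hη).le (sq_nonneg _)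
  have : Nonempty ι := by
    obtain ⟨j, _⟩ := hup η hη s₀ (Finset.mem_filter.1 hs₀).1 (Finset.mem_filter.1 hs₀).2
    exact ⟨j⟩
  choose! j hj using hup η hη
  have hj' : ∀ s ∈ S.filter (fun s => L η s < hi S c (L η) s), j s ∈ J ∧ mv (j s) η ∈ Y ∧
      L (mv (j s) η) = Function.update (L η) s (L η s + 1) := fun s hs =>
    have h := hj s (Finset.mem_filter.1 hs).1 (Finset.mem_filter.1 hs).2
    ⟨h.1, h.2.1, h.2.2.1⟩
  -- Moves raising different cells are different, so the sum over raisable cells embeds into the sum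
  -- over all moves in J.
  have hjinj : Set.InjOn j (S.filter (fun s => L η s < hi S c (L η) s) : Set (ℤ × ℤ)) := by
    intro s hs s' hs' e
    have h1 := (hj' s hs).2.2
    rw [e, (hj' s' hs').2.2] at h1
    by_contra hne
    have h2 := congrFun h1 s
    rw [Function.update_of_ne hne, Function.update_self] at h2
    omega
  have hterm : ∀ s ∈ S.filter (fun s => L η s < hi S c (L η) s),
      w η * (f (M (Function.update (L η) s (L η s + 1))) - f η) ^ 2 =
      w η * (f (mv (j s) η) - f η) ^ 2 := by
    intro s hs
    obtain ⟨_, h2, h3⟩ := hj' s hs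
    rw [← h3, hML _ h2]
  rw [Finset.sum_congr rfl hterm, ← Finset.sum_image (g := j)
    (f := fun j => w η * (f (mv j η) - f η) ^ 2) hjinj]
  refine Finset.sum_le_sum_of_subset_of_nonneg ?_ fun _ _ _ =>
    mul_nonneg (hpos η hη).le (sq_nonneg _)
  intro i hi
  obtain ⟨s, hs, rfl⟩ := Finset.mem_image.1 hi
  exact Finset.mem_filter.2 ⟨(hj' s hs).1, (hj' s hs).2.1⟩

end SkewArray

end

/-! ### Polymer configurations: admissible changes of one height, and their weights. -/

noncomputable section

namespace BiasedPaths

open Classical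

variable {k n : ℕ} {h : ℤ} {α : ℝ} {ξ σ : Path n}

/-- The height of a path at an integer abscissa. -/
def ext (p : Path n) (z : ℤ) : ℤ := p ⟨min z.toNat n, by omega⟩

theorem ext_coe (p : Path n) (x : Fin (n + 1)) : ext p (x.val : ℤ) = p x := by
  unfold ext
  congr 1
  ext
  simp only [Int.toNat_natCast]
  omega

theorem exists_fin {z : ℤ} (h0 : 0 ≤ z) (h1 : z ≤ n) : ∃ x : Fin (n + 1), (x.val : ℤ) = z :=
  ⟨⟨z.toNat, by omega⟩, by simp [h0]⟩

/-- Integer abscissae (with `ext` clamped outside [0, n]) reduce all later neighbour arguments to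
linear integer arithmetic. -/
theorem isPath_iff {p : Path n} : IsPath n h p ↔ ext p 0 = 0 ∧ ext p n = h ∧
    ∀ z : ℤ, 0 ≤ z → z < n → ext p (z + 1) = ext p z + 1 ∨ ext p (z + 1) = ext p z - 1 := by
  have e0 : ext p 0 = p 0 := by rw [← ext_coe p]; rfl
  have en : ext p n = p (Fin.last n) := by rw [← ext_coe p]; rfl
  unfold IsPath
  rw [e0, en]
  refine and_congr_right fun _ => and_congr_right fun _ => ⟨fun H z hz hz' => ?_, fun H x => ?_⟩
  · have hx := H ⟨z.toNat, by omega⟩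
    rw [← ext_coe p, ← ext_coe p (Fin.castSucc _)] at hx
    simp only [Fin.succ_mk, Fin.castSucc_mk, Nat.cast_add, Int.toNat_of_nonneg hz,
      Nat.cast_one] at hx
    omega
  · have hx := H x.val (by omega) (by omega)
    rw [← ext_coe p, ← ext_coe p (Fin.castSucc _)]
    simp only [Fin.val_succ, Fin.val_castSucc, Nat.cast_add, Nat.cast_one]
    omega

theorem IsPath.parity {p : Path n} (hp : IsPath n h p) {z : ℤ} (h0 : 0 ≤ z) (h1 : z ≤ n) :
    (ext p z + z) % 2 = 0 := by
  rw [isPath_iff] at hp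
  induction z, h0 using Int.leInduction with
  | base => rw [hp.1]; rfl
  | succ z hz ih =>
    have := ih (by omega)
    have := hp.2.2 z hz (by omega)
    omega

theorem mem_E {η : Config k n} : η ∈ E k n h ξ σ ↔ (∀ i, IsPath n h (η i)) ∧
    (∀ i j, i ≤ j → ∀ z : ℤ, 0 ≤ z → z ≤ n → ext (η j) z ≤ ext (η i) z) ∧
    ∀ i, ∀ z : ℤ, 0 ≤ z → z ≤ n → ext σ z ≤ ext (η i) z ∧ ext (η i) z ≤ ext ξ z := by
  unfold E
  rw [Finset.mem_filter, mem_Omega, IsConfig, and_assoc]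
  refine and_congr_right fun _ => and_congr ?_ ?_
  · refine forall_congr' fun i => forall_congr' fun j => imp_congr_right fun _ =>
      ⟨fun H z h0 h1 => ?_, fun H x => ?_⟩
    · obtain ⟨x, rfl⟩ := exists_fin h0 h1
      rw [ext_coe, ext_coe]
      exact H x
    · have := H x.val (by omega) (by omega)
      rwa [ext_coe, ext_coe] at this
  · refine forall_congr' fun i => ⟨fun H z h0 h1 => ?_, fun H x => ?_⟩
    · obtain ⟨x, rfl⟩ := exists_fin h0 h1
      rw [ext_coe, ext_coe, ext_coe]
      exact H x
    · have := H x.val (by omega) (by omega)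
      rwa [ext_coe, ext_coe, ext_coe] at this

theorem ext_setHeight (η : Config k n) (i j : Fin k) (x : Fin (n + 1)) (v : ℤ) {z : ℤ}
    (h0 : 0 ≤ z) (h1 : z ≤ n) :
    ext (setHeight η i x v j) z = if j = i ∧ z = x.val then v else ext (η j) z := by
  obtain ⟨y, rfl⟩ := exists_fin h0 h1
  rw [ext_coe, ext_coe]
  unfold setHeight
  by_cases hj : j = i
  · subst hj
    rw [Function.update_self]
    by_cases hy : y = x
    · subst hy
      simp
    · rw [Function.update_of_ne hy, if_neg]
      intro hc
      exact hy (Fin.ext (by exact_mod_cast hc.2))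
  · rw [Function.update_of_ne hj, if_neg fun hc => hj hc.1]

/-- The conditions under which a single height may be changed. -/
theorem setHeight_mem {η : Config k n} (hη : η ∈ E k n h ξ σ) {i : Fin k} {x : Fin (n + 1)}
    (hx0 : 1 ≤ x.val) (hxn : x.val < n) {v : ℤ}
    (hl : v = ext (η i) (x.val - 1) + 1 ∨ v = ext (η i) (x.val - 1) - 1)
    (hr : v = ext (η i) (x.val + 1) + 1 ∨ v = ext (η i) (x.val + 1) - 1)
    (habove : ∀ j : Fin k, j.val + 1 = i.val → v ≤ ext (η j) x.val)
    (hbelow : ∀ j : Fin k, j.val = i.val + 1 → ext (η j) x.val ≤ v)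
    (hσ : ext σ x.val ≤ v) (hξ : v ≤ ext ξ x.val) : setHeight η i x v ∈ E k n h ξ σ := by
  rw [mem_E] at hη ⊢
  obtain ⟨hp, ho, hb⟩ := hη
  refine ⟨fun j => ?_, fun j j' hjj z h0 h1 => ?_, fun j z h0 h1 => ?_⟩
  · have hpj := isPath_iff.1 (hp j)
    rw [isPath_iff, ext_setHeight _ _ _ _ _ le_rfl (by omega),
      ext_setHeight _ _ _ _ _ (by omega) le_rfl, if_neg (by omega), if_neg (by omega)]
    refine ⟨hpj.1, hpj.2.1, fun z h0 h1 => ?_⟩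
    rw [ext_setHeight _ _ _ _ _ h0 h1.le, ext_setHeight _ _ _ _ _ (by omega) (by omega)]
    have hz := hpj.2.2 z h0 h1
    by_cases hji : j = i
    · subst hji
      by_cases hzx : z = x.val
      · subst hzx
        rw [if_neg (by omega), if_pos ⟨rfl, rfl⟩]
        omega
      · by_cases hzx' : z + 1 = x.val
        · rw [if_pos ⟨rfl, hzx'⟩, if_neg (by omega)]
          have : z = x.val - 1 := by omega
          rw [this]
          exact hl
        · rw [if_neg (by omega), if_neg (by omega)]
          exact hz
    · rw [if_neg fun hc => hji hc.1, if_neg fun hc => hji hc.1]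
      exact hz
  · rw [ext_setHeight _ _ _ _ _ h0 h1, ext_setHeight _ _ _ _ _ h0 h1]
    have hold := ho j j' hjj z h0 h1
    by_cases hz : z = x.val
    · subst hz
      by_cases h1' : j' = i
      · by_cases h2' : j = i
        · rw [if_pos ⟨h1', rfl⟩, if_pos ⟨h2', rfl⟩]
        · rw [if_pos ⟨h1', rfl⟩, if_neg fun hc => h2' hc.1]
          have hlt : j.val < i.val := by
            have : j.val ≠ i.val := fun hc => h2' (Fin.ext hc)
            have : j.val ≤ j'.val := hjj
            rw [h1'] at this
            omega
          have e := habove ⟨i.val - 1, by omega⟩ (by simp only; omega)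
          exact e.trans (ho j _ (by rw [Fin.le_def]; simp only; omega) _ h0 h1)
      · by_cases h2' : j = i
        · rw [if_neg fun hc => h1' hc.1, if_pos ⟨h2', rfl⟩]
          have hlt : i.val < j'.val := by
            have : j'.val ≠ i.val := fun hc => h1' (Fin.ext hc)
            have : j.val ≤ j'.val := hjj
            rw [h2'] at this
            omega
          have e := hbelow ⟨i.val + 1, by omega⟩ rfl
          exact (ho _ j' (by rw [Fin.le_def]; simp only; omega) _ h0 h1).trans e
        · rw [if_neg fun hc => h1' hc.1, if_neg fun hc => h2' hc.1]
          exact hold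
    · rw [if_neg fun hc => hz hc.2, if_neg fun hc => hz hc.2]
      exact hold
  · rw [ext_setHeight _ _ _ _ _ h0 h1]
    split_ifs with hc
    · rw [hc.2]
      exact ⟨hσ, hξ⟩
    · exact hb j z h0 h1

theorem weight_pos (η : Config k n) : 0 < weight α η := Real.exp_pos _

theorem weight_setHeight (η : Config k n) (i : Fin k) (x : Fin (n + 1)) (v : ℤ) :
    weight α (setHeight η i x v) = Real.exp (α * ((v : ℝ) - η i x)) * weight α η := by
  unfold weight
  rw [← Real.exp_add]
  congr 1
  have h1 : ∑ y, ((Function.update (η i) x v y : ℤ) : ℝ) = ∑ y, (η i y : ℝ) + (v - η i x) := by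
    rw [← Finset.add_sum_erase _ _ (Finset.mem_univ x),
      ← Finset.add_sum_erase Finset.univ (fun y => (η i y : ℝ)) (Finset.mem_univ x),
      Function.update_self]
    have : ∑ y ∈ Finset.univ.erase x, ((Function.update (η i) x v y : ℤ) : ℝ) =
        ∑ y ∈ Finset.univ.erase x, (η i y : ℝ) :=
      Finset.sum_congr rfl fun y hy => by
        rw [Function.update_of_ne (Finset.ne_of_mem_erase hy)]
    rw [this]
    ring
  have h2 : ∑ j, ∑ y, (setHeight η i x v j y : ℝ) = ∑ j, ∑ y, (η j y : ℝ) + (v - η i x) := by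
    unfold setHeight
    rw [← Finset.add_sum_erase _ _ (Finset.mem_univ i),
      ← Finset.add_sum_erase Finset.univ (fun j => ∑ y, (η j y : ℝ)) (Finset.mem_univ i),
      Function.update_self, h1]
    have : ∑ j ∈ Finset.univ.erase i,
        ∑ y, (Function.update η i (Function.update (η i) x v) j y : ℝ) =
        ∑ j ∈ Finset.univ.erase i, ∑ y, (η j y : ℝ) :=
      Finset.sum_congr rfl fun j hj => by
        rw [Function.update_of_ne (Finset.ne_of_mem_erase hj)]
    rw [this]
    ring
  rw [h2]
  ring

theorem Z_pos {η : Config k n} (hη : η ∈ Omega k n h) : 0 < Z k n h α :=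
  Finset.sum_pos (fun η _ => weight_pos η) ⟨η, hη⟩

theorem mem_Omega_of_mem_E {η : Config k n} (hη : η ∈ E k n h ξ σ) : η ∈ Omega k n h :=
  (Finset.mem_filter.1 hη).1

theorem mu_pos {η : Config k n} (hη : η ∈ E k n h ξ σ) : 0 < mu k n h α η := by
  have h1 := mem_Omega_of_mem_E hη
  unfold mu
  rw [if_pos h1]
  exact div_pos (weight_pos η) (Z_pos h1)

theorem sum_mu_pos {η : Config k n} (hη : η ∈ E k n h ξ σ) :
    0 < ∑ ζ ∈ E k n h ξ σ, mu k n h α ζ :=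
  Finset.sum_pos (fun _ hζ => mu_pos hζ) ⟨η, hη⟩

theorem muCond_pos {η : Config k n} (hη : η ∈ E k n h ξ σ) : 0 < muCond k n h α ξ σ η := by
  unfold muCond
  rw [if_pos hη]
  exact div_pos (mu_pos hη) (sum_mu_pos hη)

theorem sum_muCond (hE : (E k n h ξ σ).Nonempty) :
    ∑ η ∈ E k n h ξ σ, muCond k n h α ξ σ η = 1 := by
  obtain ⟨η, hη⟩ := hE
  unfold muCond
  rw [← Finset.sum_filter, Finset.filter_true_of_mem (fun _ h => h), ← Finset.sum_div,
    div_self (sum_mu_pos hη).ne']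

theorem muCond_setHeight {η : Config k n} {i : Fin k} {x : Fin (n + 1)} {v : ℤ}
    (hη : η ∈ E k n h ξ σ) (hη' : setHeight η i x v ∈ E k n h ξ σ) :
    muCond k n h α ξ σ (setHeight η i x v) =
      Real.exp (α * ((v : ℝ) - η i x)) * muCond k n h α ξ σ η := by
  unfold muCond mu
  rw [if_pos hη, if_pos hη', if_pos (mem_Omega_of_mem_E hη), if_pos (mem_Omega_of_mem_E hη'),
    weight_setHeight]
  ring

end BiasedPaths

end

/-! ### Encoding of polymers by the number of them passing below each cell. -/

noncomputable section

namespace BiasedPaths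

open Classical SkewArray

variable {k n : ℕ} {h : ℤ} {α : ℝ} {ξ σ : Path n}

theorem IsPath.abs_ext_le {p : Path n} (hp : IsPath n h p) (z : ℤ) : |ext p z| ≤ n := by
  have h1 := hp.height_bound (min z.toNat n) (by omega)
  refine h1.trans ?_
  exact_mod_cast Nat.min_le_right _ _

/-- The unit cells between the floor and the ceiling, recorded by their centres. -/
def cells (σ ξ : Path n) : Finset (ℤ × ℤ) :=
  (Finset.Icc (0 : ℤ) n ×ˢ Finset.Icc (-(n : ℤ)) n).filter fun p =>
    ext σ p.1 < p.2 ∧ p.2 < ext ξ p.1 ∧ (p.1 + p.2) % 2 = 1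

theorem mem_cells (hσ : IsPath n h σ) (hξ : IsPath n h ξ) {z m : ℤ} : (z, m) ∈ cells σ ξ ↔
    0 < z ∧ z < n ∧ ext σ z < m ∧ m < ext ξ z ∧ (z + m) % 2 = 1 := by
  unfold cells
  simp only [Finset.mem_filter, Finset.mem_product, Finset.mem_Icc]
  have h1 := abs_le.1 (hσ.abs_ext_le z)
  have h2 := abs_le.1 (hξ.abs_ext_le z)
  constructor
  · rintro ⟨⟨⟨h3, h4⟩, -⟩, h5, h6, h7⟩
    rw [isPath_iff] at hσ hξ
    have h8 : z ≠ 0 := by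
      rintro rfl
      omega
    have h9 : z ≠ n := by
      rintro rfl
      omega
    omega
  · omega

/-- One ±1 step from z keeps the floor below m and the ceiling above m, and this strict separation
excludes the end columns, where floor and ceiling meet. -/
theorem filled_cells (hσ : IsPath n h σ) (hξ : IsPath n h ξ) : Filled (cells σ ξ) := by
  intro z m h1 h2
  rw [mem_cells hσ hξ] at h1 h2 ⊢
  rw [mem_cells hσ hξ]
  have hσ' := isPath_iff.1 hσ
  have hξ' := isPath_iff.1 hξ
  have a1 := hσ'.2.2 (z - 1) (by omega) (by omega)
  have a2 := hσ'.2.2 z (by omega) (by omega)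
  have b1 := hξ'.2.2 (z - 1) (by omega) (by omega)
  have b2 := hξ'.2.2 z (by omega) (by omega)
  rw [sub_add_cancel] at a1 b1
  have c0 : z - 1 ≠ 0 := by
    intro hc
    rw [hc] at a1 b1
    omega
  have c1 : z + 1 ≠ n := by
    intro hc
    rw [hc] at a2 b2
    omega
  omega

/-- The polymers passing below height `m` at `z`. -/
def below (η : Config k n) (z m : ℤ) : Finset (Fin k) :=
  Finset.univ.filter fun i => ext (η i) z < m

/-- The number of polymers passing below each cell. -/
def heights (σ ξ : Path n) (η : Config k n) (p : ℤ × ℤ) : ℕ :=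
  if p ∈ cells σ ξ then (below η p.1 p.2).card else 0

/-- The polymers are ordered, so those below m form a final segment of indices, which its
cardinality determines. -/
theorem ext_lt_iff {η : Config k n} (hη : η ∈ E k n h ξ σ) {z : ℤ} (h0 : 0 ≤ z) (h1 : z ≤ n)
    (m : ℤ) (i : Fin k) : ext (η i) z < m ↔ k ≤ i.val + (below η z m).card := by
  have ho := (mem_E.1 hη).2.1
  constructor
  · intro hlt
    have hsub : Finset.Ici i ⊆ below η z m := fun j hj =>
      Finset.mem_filter.2 ⟨Finset.mem_univ j, (ho i j (Finset.mem_Ici.1 hj) z h0 h1).trans_lt hlt⟩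
    have := Finset.card_le_card hsub
    rw [Fin.card_Ici] at this
    omega
  · intro hle
    by_contra hge
    have hsub : below η z m ⊆ Finset.Ioi i := fun j hj => by
      rw [Finset.mem_Ioi]
      by_contra hji
      exact hge ((ho j i (not_lt.1 hji) z h0 h1).trans_lt (Finset.mem_filter.1 hj).2)
    have := Finset.card_le_card hsub
    rw [Fin.card_Ioi] at this
    omega

theorem isArray_heights {η : Config k n} (hη : η ∈ E k n h ξ σ) (hσ : IsPath n h σ)
    (hξ : IsPath n h ξ) : IsArray (cells σ ξ) k (heights σ ξ η) := by
  have hp := fun i => isPath_iff.1 ((mem_E.1 hη).1 i)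
  refine ⟨fun p hpn => if_neg hpn, fun p => ?_, ?_, ?_⟩
  · unfold heights
    split_ifs
    · exact (Finset.card_le_univ _).trans (by simp)
    · exact Nat.zero_le _
  · rintro ⟨z, m⟩ hs
    unfold heights
    rw [if_pos hs]
    rw [mem_cells hσ hξ] at hs
    split_ifs
    · refine Finset.card_le_card fun i hi => ?_
      simp only [below, Finset.mem_filter, Finset.mem_univ, true_and] at hi ⊢
      have := (hp i).2.2 (z - 1) (by omega) (by omega)
      rw [sub_add_cancel] at this
      omega
    · exact Nat.zero_le _
  · rintro ⟨z, m⟩ hs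
    unfold heights
    rw [if_pos hs]
    rw [mem_cells hσ hξ] at hs
    split_ifs
    · refine Finset.card_le_card fun i hi => ?_
      simp only [below, Finset.mem_filter, Finset.mem_univ, true_and] at hi ⊢
      have := (hp i).2.2 z (by omega) (by omega)
      omega
    · exact Nat.zero_le _

/-- If the i-th polymer is lower in one configuration than in the other, parity separates the two
heights by at least 2, and the cell just above the lower one has the polymer below it in one case
only. By `ext_lt_iff` the counts differ. -/
theorem eq_of_heights_eq (hσ : IsPath n h σ) (hξ : IsPath n h ξ) {η η' : Config k n}
    (hη : η ∈ E k n h ξ σ) (hη' : η' ∈ E k n h ξ σ) (he : heights σ ξ η = heights σ ξ η') :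
    η = η' := by
  have key : ∀ η ∈ E k n h ξ σ, ∀ η' ∈ E k n h ξ σ, heights σ ξ η = heights σ ξ η' →
      ∀ i, ∀ z : ℤ, 0 ≤ z → z ≤ n → ext (η' i) z ≤ ext (η i) z := by
    intro η hη η' hη' he i z h0 h1
    by_contra! hlt
    obtain ⟨hp, -, hb⟩ := mem_E.1 hη
    obtain ⟨hp', -, hb'⟩ := mem_E.1 hη'
    have q1 := (hp i).parity h0 h1
    have q2 := (hp' i).parity h0 h1
    have b1 := hb i z h0 h1
    have b2 := hb' i z h0 h1
    have hz0 : z ≠ 0 := by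
      rintro rfl
      rw [(isPath_iff.1 (hp i)).1, (isPath_iff.1 (hp' i)).1] at hlt
      exact lt_irrefl _ hlt
    have hzn : z ≠ n := by
      rintro rfl
      rw [(isPath_iff.1 (hp i)).2.1, (isPath_iff.1 (hp' i)).2.1] at hlt
      exact lt_irrefl _ hlt
    have hcell : (z, ext (η i) z + 1) ∈ cells σ ξ := by
      rw [mem_cells hσ hξ]
      omega
    have h2 := congrFun he (z, ext (η i) z + 1)
    simp only [heights, if_pos hcell] at h2
    have h3 := (ext_lt_iff hη h0 h1 (ext (η i) z + 1) i).1 (by omega)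
    rw [h2, ← ext_lt_iff hη' h0 h1] at h3
    omega
  funext i x
  have h1 := key η hη η' hη' he i x.val (by omega) (by omega)
  have h2 := key η' hη' η hη he.symm i x.val (by omega) (by omega)
  rw [ext_coe, ext_coe] at h1 h2
  exact le_antisymm h2 h1

/-- Lowering a polymer across a cell increases the height of that cell by one. -/
theorem heights_setHeight (hσ : IsPath n h σ) (hξ : IsPath n h ξ) {η : Config k n}
    {i : Fin k} {x : Fin (n + 1)} {m : ℤ} (hcell : ((x.val : ℤ), m) ∈ cells σ ξ) (hm : ext (η i) x.val = m + 1) :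
    heights σ ξ (setHeight η i x (m - 1)) =
      Function.update (heights σ ξ η) (x.val, m) (heights σ ξ η (x.val, m) + 1) := by
  funext ⟨z, m'⟩
  by_cases hs : (z, m') ∈ cells σ ξ
  swap
  · rw [Function.update_of_ne]
    · simp only [heights, if_neg hs]
    · rintro hc
      rw [hc] at hs
      exact hs hcell
  have hmem := (mem_cells hσ hξ).1 hs
  have hmem' := (mem_cells hσ hξ).1 hcell
  by_cases heq : (z, m') = ((x.val : ℤ), m)
  · rw [heq, Function.update_self]
    simp only [heights, if_pos hcell]
    have : below (setHeight η i x (m - 1)) x.val m = insert i (below η x.val m) := by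
      ext j
      simp only [below, Finset.mem_filter, Finset.mem_univ, true_and, Finset.mem_insert]
      rw [ext_setHeight _ _ _ _ _ hmem'.1.le hmem'.2.1.le]
      by_cases hj : j = i
      · simp [hj]
      · simp [hj]
    rw [this, Finset.card_insert_of_notMem]
    simp only [below, Finset.mem_filter, Finset.mem_univ, true_and, hm]
    omega
  · rw [Function.update_of_ne heq]
    simp only [heights, if_pos hs]
    congr 1
    ext j
    simp only [below, Finset.mem_filter, Finset.mem_univ, true_and]
    rw [ext_setHeight _ _ _ _ _ hmem.1.le hmem.2.1.le]
    split_ifs with hc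
    · obtain ⟨rfl, rfl⟩ := hc
      rw [hm]
      have : m' ≠ m := fun hc => heq (by rw [hc])
      omega
    · rfl

theorem exists_lower (hσ : IsPath n h σ) (hξ : IsPath n h ξ) {η : Config k n}
    (hη : η ∈ E k n h ξ σ) {s : ℤ × ℤ} (hs : s ∈ cells σ ξ)
    (hlt : heights σ ξ η s < hi (cells σ ξ) k (heights σ ξ η) s) :
    ∃ (i : Fin k) (x : Fin (n + 1)), (1 ≤ x.val ∧ x.val ≤ n - 1) ∧
      setHeight η i x (η i x - 2) ∈ E k n h ξ σ ∧ heights σ ξ (setHeight η i x (η i x - 2)) =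
        Function.update (heights σ ξ η) s (heights σ ξ η s + 1) := by
  obtain ⟨z, m⟩ := s
  have hmem := (mem_cells hσ hξ).1 hs
  obtain ⟨x, rfl⟩ := exists_fin hmem.1.le hmem.2.1.le
  have hA := isArray_heights hη hσ hξ
  have hk : heights σ ξ η (x.val, m) < k :=
    hlt.trans_le ((min_le_left _ _).trans (hA.cap_le _))
  obtain ⟨h1, h2⟩ := lt_min_iff.1 hlt
  simp only [cap] at h1 h2
  set t := heights σ ξ η (x.val, m) with ht
  have ht' : t = (below η x.val m).card := by rw [ht]; simp only [heights, if_pos hs]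
  obtain ⟨hp, ho, hb⟩ := mem_E.1 hη
  -- The lowest polymer that does not pass below the cell.
  set i : Fin k := ⟨k - 1 - t, by omega⟩ with hi
  have hiff := ext_lt_iff hη (z := x.val) hmem.1.le hmem.2.1.le m
  rw [← ht'] at hiff
  have e0 : ¬ ext (η i) x.val < m := by
    rw [hiff, hi]
    simp only
    omega
  have par := (hp i).parity (z := x.val) hmem.1.le hmem.2.1.le
  -- The upper left cell has more than t polymers below it, hence also this one; if it is not a
  -- cell, the ceiling or the fixed endpoint gives the bound. The same on the right makes (i, x) a
  -- local maximum.
  have el : ext (η i) (x.val - 1) ≤ m := by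
    have par := (hp i).parity (z := x.val - 1) (by omega) (by omega)
    split_ifs at h1 with hc
    · simp only [heights, if_pos hc] at h1
      have := (ext_lt_iff hη (z := x.val - 1) (by omega) (by omega) (m + 1) i).2
        (by rw [hi]; simp only; omega)
      omega
    · have hn := mt (mem_cells hσ hξ).2 hc
      have hst := (isPath_iff.1 hσ).2.2 (x.val - 1) (by omega) (by omega)
      rw [sub_add_cancel] at hst
      have hst' := (isPath_iff.1 (hp i)).2.2 (x.val - 1) (by omega) (by omega)
      rw [sub_add_cancel] at hst'
      have hbb := hb i (x.val - 1) (by omega) (by omega)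
      by_cases hx1 : (x.val : ℤ) - 1 = 0
      · rw [hx1] at hst hst' hbb ⊢
        rw [(isPath_iff.1 hσ).1] at hst
        rw [(isPath_iff.1 (hp i)).1]
        omega
      · omega
  have er : ext (η i) (x.val + 1) ≤ m := by
    have par := (hp i).parity (z := x.val + 1) (by omega) (by omega)
    split_ifs at h2 with hc
    · simp only [heights, if_pos hc] at h2
      have := (ext_lt_iff hη (z := x.val + 1) (by omega) (by omega) (m + 1) i).2
        (by rw [hi]; simp only; omega)
      omega
    · have hn := mt (mem_cells hσ hξ).2 hc
      have hst := (isPath_iff.1 hσ).2.2 x.val (by omega) (by omega)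
      have hbb := hb i (x.val + 1) (by omega) (by omega)
      by_cases hx1 : (x.val : ℤ) + 1 = n
      · rw [hx1] at hst ⊢
        rw [(isPath_iff.1 hσ).2.1] at hst
        rw [(isPath_iff.1 (hp i)).2.1]
        omega
      · omega
  have sl := (isPath_iff.1 (hp i)).2.2 (x.val - 1) (by omega) (by omega)
  rw [sub_add_cancel] at sl
  have sr := (isPath_iff.1 (hp i)).2.2 x.val (by omega) (by omega)
  have hv : ext (η i) x.val = m + 1 := by omega
  have hv' : η i x - 2 = m - 1 := by
    rw [← ext_coe (η i)]
    omega
  refine ⟨i, x, by omega, ?_, ?_⟩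
  · rw [hv']
    have hbb := hb i x.val (by omega) (by omega)
    refine setHeight_mem hη (by omega) (by omega) (by omega) (by omega) ?_ ?_ (by omega) (by omega)
    · intro j hj
      have := ho j i (by rw [Fin.le_def]; omega) x.val (by omega) (by omega)
      omega
    · intro j hj
      have h3 := (hiff j).2 (by rw [hj, hi]; simp only; omega)
      omega
  · rw [hv']
    exact heights_setHeight hσ hξ hs hv

theorem exists_raise (hσ : IsPath n h σ) (hξ : IsPath n h ξ) {η : Config k n}
    (hη : η ∈ E k n h ξ σ) {s : ℤ × ℤ} (hs : s ∈ cells σ ξ)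
    (hlt : lo (heights σ ξ η) s < heights σ ξ η s) :
    ∃ η' ∈ E k n h ξ σ, heights σ ξ η' =
        Function.update (heights σ ξ η) s (heights σ ξ η s - 1) := by
  obtain ⟨z, m⟩ := s
  have hmem := (mem_cells hσ hξ).1 hs
  obtain ⟨x, rfl⟩ := exists_fin hmem.1.le hmem.2.1.le
  have hA := isArray_heights hη hσ hξ
  have hk := hA.le (x.val, m)
  obtain ⟨h1, h2⟩ := max_lt_iff.1 hlt
  simp only at h1 h2
  set t := heights σ ξ η (x.val, m) with ht
  have ht' : t = (below η x.val m).card := by rw [ht]; simp only [heights, if_pos hs]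
  obtain ⟨hp, ho, hb⟩ := mem_E.1 hη
  -- The highest polymer passing below the cell; it is shown to have a local minimum there.
  set i : Fin k := ⟨k - t, by omega⟩ with hi
  have hiff := ext_lt_iff hη (z := x.val) hmem.1.le hmem.2.1.le m
  rw [← ht'] at hiff
  have e0 : ext (η i) x.val < m := by
    rw [hiff, hi]
    simp only
    omega
  have par := (hp i).parity (z := x.val) hmem.1.le hmem.2.1.le
  have el : m ≤ ext (η i) (x.val - 1) := by
    have par := (hp i).parity (z := x.val - 1) (by omega) (by omega)
    by_cases hc : ((x.val : ℤ) - 1, m - 1) ∈ cells σ ξ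
    · simp only [heights, if_pos hc] at h1
      have := mt (ext_lt_iff hη (z := x.val - 1) (by omega) (by omega) (m - 1) i).1
        (by rw [hi]; simp only; omega)
      omega
    · have hn := mt (mem_cells hσ hξ).2 hc
      have hst := (isPath_iff.1 hξ).2.2 (x.val - 1) (by omega) (by omega)
      rw [sub_add_cancel] at hst
      have hbb := hb i (x.val - 1) (by omega) (by omega)
      by_cases hx1 : (x.val : ℤ) - 1 = 0
      · rw [hx1] at hst ⊢
        rw [(isPath_iff.1 hξ).1] at hst
        rw [(isPath_iff.1 (hp i)).1]
        omega
      · omega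
  have er : m ≤ ext (η i) (x.val + 1) := by
    have par := (hp i).parity (z := x.val + 1) (by omega) (by omega)
    by_cases hc : ((x.val : ℤ) + 1, m - 1) ∈ cells σ ξ
    · simp only [heights, if_pos hc] at h2
      have := mt (ext_lt_iff hη (z := x.val + 1) (by omega) (by omega) (m - 1) i).1
        (by rw [hi]; simp only; omega)
      omega
    · have hn := mt (mem_cells hσ hξ).2 hc
      have hst := (isPath_iff.1 hξ).2.2 x.val (by omega) (by omega)
      have hbb := hb i (x.val + 1) (by omega) (by omega)
      by_cases hx1 : (x.val : ℤ) + 1 = n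
      · rw [hx1] at hst ⊢
        rw [(isPath_iff.1 hξ).2.1] at hst
        rw [(isPath_iff.1 (hp i)).2.1]
        omega
      · omega
  have sl := (isPath_iff.1 (hp i)).2.2 (x.val - 1) (by omega) (by omega)
  rw [sub_add_cancel] at sl
  have sr := (isPath_iff.1 (hp i)).2.2 x.val (by omega) (by omega)
  have hv : ext (η i) x.val = m - 1 := by omega
  have hbb := hb i x.val (by omega) (by omega)
  have parξ := hξ.parity (z := x.val) (by omega) (by omega)
  have hE : setHeight η i x (m + 1) ∈ E k n h ξ σ := by
    refine setHeight_mem hη (by omega) (by omega) (by omega) (by omega) ?_ ?_ (by omega) (by omega)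
    · intro j hj
      have h3 := mt (hiff j).1 (by rw [hi] at hj; simp only at hj; omega)
      have := (hp j).parity (z := x.val) (by omega) (by omega)
      omega
    · intro j hj
      have := ho i j (by rw [Fin.le_def]; omega) x.val (by omega) (by omega)
      omega
  refine ⟨_, hE, ?_⟩
  -- The effect of raising on the heights is read off from the inverse lowering.
  have hback : setHeight (setHeight η i x (m + 1)) i x (m - 1) = η := by
    rw [← hv, ext_coe]
    unfold setHeight
    simp
  have hfin := heights_setHeight hσ hξ hs (η := setHeight η i x (m + 1)) (i := i)
    (by rw [ext_setHeight _ _ _ _ _ (by omega) (by omega), if_pos ⟨rfl, rfl⟩])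
  rw [hback] at hfin
  have h3 : t = heights σ ξ (setHeight η i x (m + 1)) (x.val, m) + 1 := by
    rw [ht, hfin, Function.update_self]
  rw [hfin, Function.update_idem, h3, Nat.add_sub_cancel, Function.update_eq_self]

/-- Poincaré inequality for polymers in terms of elementary flips. -/
theorem variance_le_flips (hα : 0 < α) (hσ : IsPath n h σ) (hξ : IsPath n h ξ)
    (hE : (E k n h ξ σ).Nonempty) (f : Config k n → ℝ) :
    variance k n h α ξ σ f ≤ poincareConst (Real.exp (-α)) *
      ∑ j ∈ Finset.univ ×ˢ Finset.univ.filter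
        (fun x : Fin (n + 1) => 1 ≤ x.val ∧ x.val ≤ n - 1),
        ∑ η ∈ (E k n h ξ σ).filter
          (fun η => setHeight η j.1 j.2 (η j.1 j.2 - 2) ∈ E k n h ξ σ),
          muCond k n h α ξ σ η * (f (setHeight η j.1 j.2 (η j.1 j.2 - 2)) - f η) ^ 2 := by
  have main := variance_le_of_encoding (Y := E k n h ξ σ) (w := muCond k n h α ξ σ)
    (r := Real.exp (-α)) (Real.exp_pos _) (by simpa using hα)
    (filled_cells hσ hξ) (heights σ ξ) (Finset.univ ×ˢ Finset.univ.filter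
      (fun x : Fin (n + 1) => 1 ≤ x.val ∧ x.val ≤ n - 1)) (fun j η =>
      setHeight η j.1 j.2 (η j.1 j.2 - 2))
    (fun η h1 η' h2 e => eq_of_heights_eq hσ hξ h1 h2 e) (fun η h1 => muCond_pos h1)
    (sum_muCond hE) (fun η h1 => isArray_heights h1 hσ hξ) ?_
    (fun η h1 s hs hlt => exists_raise hσ hξ h1 hs hlt) f
  · convert main
    rfl
  intro η h1 s hs hlt
  obtain ⟨i, x, hx, h2, h3⟩ := exists_lower hσ hξ h1 hs hlt
  refine ⟨(i, x), Finset.mk_mem_product (Finset.mem_univ _)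
    (Finset.mem_filter.2 ⟨Finset.mem_univ _, hx⟩), h2, h3, ?_⟩
  simp only
  rw [muCond_setHeight h1 h2]
  congr 1
  rw [← Real.exp_nat_mul]
  congr 1
  push_cast
  ring

end BiasedPaths

end

/-! ### The local variances of the polymer heat bath and the bound on its gap. -/

noncomputable section

namespace BiasedPaths

open Classical SkewArray

variable {k n : ℕ} {h : ℤ} {α : ℝ} {ξ σ : Path n}

theorem prob_eq (A : Config k n → Prop) [DecidablePred A] :
    prob k n h α ξ σ A = ∑ η ∈ (E k n h ξ σ).filter A, muCond k n h α ξ σ η := by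
  unfold prob
  congr!

theorem prob_nonneg (A : Config k n → Prop) : 0 ≤ prob k n h α ξ σ A :=
  Finset.sum_nonneg fun _ hη => (muCond_pos (Finset.mem_filter.1 hη).1).le

theorem prob_agreeNbrs_pos {η : Config k n} (hη : η ∈ E k n h ξ σ) (i : Fin k)
    (x : Fin (n + 1)) : 0 < prob k n h α ξ σ (fun ζ => AgreeNbrs i x η ζ) :=
  Finset.sum_pos (fun _ hη => muCond_pos (Finset.mem_filter.1 hη).1)
    ⟨η, Finset.mem_filter.2 ⟨hη, fun _ _ => rfl, fun _ _ => rfl⟩⟩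

theorem sum_heightLaw {η : Config k n} (hη : η ∈ E k n h ξ σ) (i : Fin k) (x : Fin (n + 1)) :
    ∑ v ∈ Finset.Icc (-(n : ℤ)) n, heightLaw k n h α ξ σ i x η v = 1 := by
  unfold heightLaw
  rw [← Finset.sum_div, div_eq_one_iff_eq (prob_agreeNbrs_pos hη i x).ne']
  simp only [prob_eq]
  have hmaps : ∀ ζ ∈ (E k n h ξ σ).filter (fun ζ => AgreeNbrs i x η ζ),
      ζ i x ∈ Finset.Icc (-(n : ℤ)) n := by
    intro ζ hζ
    have := abs_le.1 (((mem_E.1 (Finset.mem_filter.1 hζ).1).1 i).abs_ext_le x.val)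
    rw [ext_coe] at this
    exact Finset.mem_Icc.2 this
  rw [← Finset.sum_fiberwise_of_maps_to hmaps]
  refine Finset.sum_congr rfl fun v _ => ?_
  rw [Finset.filter_filter]

theorem heightLaw_nonneg (i : Fin k) (x : Fin (n + 1)) (η : Config k n) (v : ℤ) :
    0 ≤ heightLaw k n h α ξ σ i x η v :=
  div_nonneg (prob_nonneg _) (prob_nonneg _)

/-- The local variance as a second moment about an arbitrary constant. -/
theorem localVariance_eq {η : Config k n} (hη : η ∈ E k n h ξ σ) (i : Fin k) (x : Fin (n + 1))
    (f : Config k n → ℝ) :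
    localVariance k n h α ξ σ i x f η = ∑ v ∈ Finset.Icc (-(n : ℤ)) n,
      heightLaw k n h α ξ σ i x η v *
        (f (setHeight η i x v) - localExpect k n h α ξ σ i x f η) ^ 2 := by
  set e := localExpect k n h α ξ σ i x f η with he
  have h1 : ∀ v, heightLaw k n h α ξ σ i x η v * (f (setHeight η i x v) - e) ^ 2 =
      heightLaw k n h α ξ σ i x η v * f (setHeight η i x v) ^ 2 -
      2 * e * (heightLaw k n h α ξ σ i x η v * f (setHeight η i x v)) +
      e ^ 2 * heightLaw k n h α ξ σ i x η v := fun v => by ring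
  simp only [h1, Finset.sum_add_distrib, Finset.sum_sub_distrib, ← Finset.mul_sum,
    sum_heightLaw hη]
  have h2 : ∑ v ∈ Finset.Icc (-(n : ℤ)) n,
    heightLaw k n h α ξ σ i x η v * f (setHeight η i x v) = e := rfl
  rw [h2]
  unfold localVariance
  rw [← he]
  unfold localExpect
  ring

theorem localVariance_nonneg {η : Config k n} (hη : η ∈ E k n h ξ σ) (i : Fin k)
    (x : Fin (n + 1)) (f : Config k n → ℝ) : 0 ≤ localVariance k n h α ξ σ i x f η := by
  rw [localVariance_eq hη]
  exact Finset.sum_nonneg fun v _ => mul_nonneg (heightLaw_nonneg i x η v) (sq_nonneg _)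

theorem setHeight_setHeight (η : Config k n) (i : Fin k) (x : Fin (n + 1)) (v v' : ℤ) :
    setHeight (setHeight η i x v) i x v' = setHeight η i x v' := by
  unfold setHeight
  simp

theorem setHeight_self (η : Config k n) (i : Fin k) (x : Fin (n + 1)) :
    setHeight η i x (η i x) = η := by
  unfold setHeight
  simp

theorem setHeight_apply (η : Config k n) (i : Fin k) (x : Fin (n + 1)) (v : ℤ) :
    setHeight η i x v i x = v := by
  unfold setHeight
  simp

theorem agreeNbrs_setHeight {η ζ : Config k n} {i : Fin k} {x : Fin (n + 1)}
    (h1 : AgreeNbrs i x η ζ) (v : ℤ) : AgreeNbrs i x η (setHeight ζ i x v) := by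
  refine ⟨fun y hy => ?_, fun j hj => ?_⟩
  · have : y ≠ x := by
      rintro rfl
      omega
    unfold setHeight
    rw [Function.update_self, Function.update_of_ne this]
    exact h1.1 y hy
  · have : j ≠ i := by
      rintro rfl
      omega
    unfold setHeight
    rw [Function.update_of_ne this]
    exact h1.2 j hj

/-- A height that fits at `(i, x)` in `η` also fits in every configuration with the same
neighbouring heights. -/
theorem setHeight_mem_of_agreeNbrs {η ζ : Config k n} {i : Fin k} {x : Fin (n + 1)} {v : ℤ}
    (hx0 : 1 ≤ x.val) (hxn : x.val < n) (hη : setHeight η i x v ∈ E k n h ξ σ)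
    (hζ : ζ ∈ E k n h ξ σ) (h1 : AgreeNbrs i x η ζ) : setHeight ζ i x v ∈ E k n h ξ σ := by
  obtain ⟨hp, ho, hb⟩ := mem_E.1 hη
  have hv : ext (setHeight η i x v i) x.val = v := by rw [ext_coe, setHeight_apply]
  have hnb : ∀ z : ℤ, 0 ≤ z → z ≤ n → (z + 1 = x.val ∨ z = x.val + 1) →
      ext (setHeight η i x v i) z = ext (ζ i) z := by
    intro z h0 h2 hz
    rw [ext_setHeight _ _ _ _ _ h0 h2, if_neg (by omega)]
    obtain ⟨y, rfl⟩ := exists_fin h0 h2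
    rw [ext_coe, ext_coe, h1.1 y (by omega)]
  have hnb' : ∀ j : Fin k, (j.val + 1 = i.val ∨ j.val = i.val + 1) →
      ext (setHeight η i x v j) x.val = ext (ζ j) x.val := by
    intro j hj
    rw [ext_setHeight _ _ _ _ _ (by omega) (by omega), if_neg (by rintro ⟨rfl, -⟩; omega),
      ext_coe, ext_coe, h1.2 j hj]
  have sl := (isPath_iff.1 (hp i)).2.2 (x.val - 1) (by omega) (by omega)
  rw [sub_add_cancel, hv, hnb _ (by omega) (by omega) (by omega)] at sl
  have sr := (isPath_iff.1 (hp i)).2.2 x.val (by omega) (by omega)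
  rw [hv, hnb _ (by omega) (by omega) (by omega)] at sr
  have hbi := hb i x.val (by omega) (by omega)
  rw [hv] at hbi
  refine setHeight_mem hζ hx0 hxn (by omega) (by omega) ?_ ?_ hbi.1 hbi.2
  · intro j hj
    have := ho j i (by rw [Fin.le_def]; omega) x.val (by omega) (by omega)
    rwa [hv, hnb' j (by omega)] at this
  · intro j hj
    have := ho i j (by rw [Fin.le_def]; omega) x.val (by omega) (by omega)
    rwa [hv, hnb' j (by omega)] at this

/-- At a flippable site, the heat-bath variance is the variance of a Bernoulli variable. -/
theorem localVariance_flip {η : Config k n} {i : Fin k} {x : Fin (n + 1)}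
    (hx0 : 1 ≤ x.val) (hxn : x.val ≤ n - 1) (hη : η ∈ E k n h ξ σ)
    (hη' : setHeight η i x (η i x - 2) ∈ E k n h ξ σ) (f : Config k n → ℝ) :
    localVariance k n h α ξ σ i x f η = Real.exp (-2 * α) / (1 + Real.exp (-2 * α)) ^ 2 *
      (f (setHeight η i x (η i x - 2)) - f η) ^ 2 := by
  set q := Real.exp (-2 * α) with hq
  have hq0 : 0 < q := Real.exp_pos _
  set u := η i x with hu
  have hxn' : x.val < n := by omega
  have hself : setHeight η i x u = η := setHeight_self η i x
  have hηu : setHeight η i x u ∈ E k n h ξ σ := by rwa [hself]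
  set N : ℤ → ℝ := fun v => prob k n h α ξ σ (fun ζ => AgreeNbrs i x η ζ ∧ ζ i x = v) with hN
  -- Whether a height fits depends only on the neighbouring heights, so changing the one height is a
  -- bijection between the two events; it multiplies every weight by the same factor.
  have hNlow : N (u - 2) = q * N u := by
    simp only [hN, prob_eq]
    rw [Finset.mul_sum]
    refine Finset.sum_nbij' (fun ζ => setHeight ζ i x u) (fun ζ => setHeight ζ i x (u - 2))
      ?_ ?_ ?_ ?_ ?_
    · intro ζ hζ
      obtain ⟨h1, h2, h3⟩ := Finset.mem_filter.1 hζ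
      exact Finset.mem_filter.2 ⟨setHeight_mem_of_agreeNbrs hx0 hxn' hηu h1 h2,
        agreeNbrs_setHeight h2 _, setHeight_apply ζ i x u⟩
    · intro ζ hζ
      obtain ⟨h1, h2, h3⟩ := Finset.mem_filter.1 hζ
      exact Finset.mem_filter.2 ⟨setHeight_mem_of_agreeNbrs hx0 hxn' hη' h1 h2,
        agreeNbrs_setHeight h2 _, setHeight_apply ζ i x _⟩
    · intro ζ hζ
      obtain ⟨h1, h2, h3⟩ := Finset.mem_filter.1 hζ
      rw [setHeight_setHeight, ← h3, setHeight_self]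
    · intro ζ hζ
      obtain ⟨h1, h2, h3⟩ := Finset.mem_filter.1 hζ
      rw [setHeight_setHeight, ← h3, setHeight_self]
    · intro ζ hζ
      obtain ⟨h1, h2, h3⟩ := Finset.mem_filter.1 hζ
      rw [muCond_setHeight h1 (setHeight_mem_of_agreeNbrs hx0 hxn' hηu h1 h2), ← mul_assoc, hq,
        ← Real.exp_add, h3]
      have : -2 * α + α * ((u : ℝ) - ((u - 2 : ℤ) : ℝ)) = 0 := by
        push_cast
        ring
      rw [this, Real.exp_zero, one_mul]
  have hNpos : 0 < N u := by
    simp only [hN, prob_eq]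
    exact Finset.sum_pos (fun _ hη => muCond_pos (Finset.mem_filter.1 hη).1)
      ⟨η, Finset.mem_filter.2 ⟨hη, ⟨fun _ _ => rfl, fun _ _ => rfl⟩, rfl⟩⟩
  have hstep : ∀ ζ ∈ E k n h ξ σ, (ζ i x = ext (ζ i) (x.val - 1) + 1 ∨
      ζ i x = ext (ζ i) (x.val - 1) - 1) ∧ (ext (ζ i) (x.val + 1) = ζ i x + 1 ∨
      ext (ζ i) (x.val + 1) = ζ i x - 1) := by
    intro ζ hζ
    have hp := isPath_iff.1 ((mem_E.1 hζ).1 i)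
    have sl := hp.2.2 (x.val - 1) (by omega) (by omega)
    have sr := hp.2.2 x.val (by omega) (by omega)
    rw [sub_add_cancel] at sl
    rw [ext_coe] at sl sr
    exact ⟨sl, sr⟩
  have hext : ∀ z : ℤ, 0 ≤ z → z ≤ n → z ≠ x.val →
      ext (setHeight η i x (u - 2) i) z = ext (η i) z := fun z h0 h1 hne => by
    rw [ext_setHeight _ _ _ _ _ h0 h1, if_neg fun hc => hne hc.2]
  have s1 := hstep η hη
  have s2 := hstep _ hη'
  rw [setHeight_apply, hext _ (by omega) (by omega) (by omega),
    hext _ (by omega) (by omega) (by omega)] at s2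
  rw [← hu] at s1
  -- Both u and u - 2 fit, so the heights at x - 1 and x + 1 equal u - 1 and no third value is
  -- possible.
  have hzero : ∀ v, v ≠ u → v ≠ u - 2 → N v = 0 := by
    intro v hv1 hv2
    simp only [hN, prob_eq]
    rw [Finset.filter_false_of_mem, Finset.sum_empty]
    rintro ζ hζ ⟨h1, h2⟩
    have s3 := hstep ζ hζ
    have e1 : ext (ζ i) (x.val - 1) = ext (η i) (x.val - 1) := by
      obtain ⟨y, hy⟩ := exists_fin (n := n) (z := x.val - 1) (by omega) (by omega)
      rw [← hy, ext_coe, ext_coe, h1.1 y (by omega)]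
    rw [e1, h2] at s3
    omega
  have hmemIcc : ∀ ζ ∈ E k n h ξ σ, ζ i x ∈ Finset.Icc (-(n : ℤ)) n := by
    intro ζ hζ
    have := abs_le.1 (((mem_E.1 hζ).1 i).abs_ext_le x.val)
    rw [ext_coe] at this
    exact Finset.mem_Icc.2 this
  have hm1 : u ∈ Finset.Icc (-(n : ℤ)) n := hmemIcc η hη
  have hm2 : u - 2 ∈ Finset.Icc (-(n : ℤ)) n := by
    have := hmemIcc _ hη'
    rwa [setHeight_apply] at this
  set D := prob k n h α ξ σ (fun ζ => AgreeNbrs i x η ζ) with hD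
  have hlaw : ∀ v, heightLaw k n h α ξ σ i x η v = N v / D := fun v => rfl
  have hsum : ∀ G : ℤ → ℝ, ∑ v ∈ Finset.Icc (-(n : ℤ)) n, heightLaw k n h α ξ σ i x η v * G v =
      N u / D * G u + q * N u / D * G (u - 2) := by
    intro G
    have hsub : ({u, u - 2} : Finset ℤ) ⊆ Finset.Icc (-(n : ℤ)) n := by
      intro v hv
      rw [Finset.mem_insert, Finset.mem_singleton] at hv
      rcases hv with rfl | rfl
      · exact hm1
      · exact hm2
    rw [← Finset.sum_subset hsub, Finset.sum_pair (by omega), hlaw, hlaw, hNlow]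
    intro v _ hv
    rw [Finset.mem_insert, Finset.mem_singleton, not_or] at hv
    rw [hlaw, hzero v hv.1 hv.2, zero_div, zero_mul]
  have hDpos : 0 < D := prob_agreeNbrs_pos hη i x
  have hDeq : D = (1 + q) * N u := by
    have h1 := sum_heightLaw (α := α) hη i x
    have h2 := hsum (fun _ => 1)
    simp only [mul_one] at h2
    rw [h1] at h2
    field_simp at h2
    linarith
  have hp1 : N u / D = 1 / (1 + q) := by
    rw [hDeq]
    field_simp
  have hp2 : q * N u / D = q / (1 + q) := by
    rw [mul_div_assoc, hp1]
    ring
  unfold localVariance localExpect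
  rw [hsum fun v => f (setHeight η i x v) ^ 2, hsum fun v => f (setHeight η i x v), hp1, hp2,
    hself]
  field_simp
  ring

/-- Each flip is counted from its upper configuration only; the remaining local variances are
nonnegative and are dropped. -/
theorem flips_le_dirichlet (f : Config k n → ℝ) :
    Real.exp (-2 * α) / (1 + Real.exp (-2 * α)) ^ 2 *
      ∑ j ∈ Finset.univ ×ˢ Finset.univ.filter
        (fun x : Fin (n + 1) => 1 ≤ x.val ∧ x.val ≤ n - 1),
        ∑ η ∈ (E k n h ξ σ).filter
          (fun η => setHeight η j.1 j.2 (η j.1 j.2 - 2) ∈ E k n h ξ σ),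
          muCond k n h α ξ σ η * (f (setHeight η j.1 j.2 (η j.1 j.2 - 2)) - f η) ^ 2 ≤
      dirichlet k n h α ξ σ f := by
  unfold dirichlet expect
  rw [Finset.sum_product, Finset.mul_sum]
  refine Finset.sum_le_sum fun i _ => ?_
  rw [Finset.mul_sum]
  refine Finset.sum_le_sum fun x hx => ?_
  obtain ⟨hx0, hxn⟩ := (Finset.mem_filter.1 hx).2
  rw [Finset.mul_sum]
  refine le_trans (le_of_eq ?_) (Finset.sum_le_sum_of_subset_of_nonneg (Finset.filter_subset
    (fun η => setHeight η i x (η i x - 2) ∈ E k n h ξ σ) (E k n h ξ σ)) fun η hη _ =>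
    mul_nonneg (muCond_pos hη).le (localVariance_nonneg hη i x f))
  refine Finset.sum_congr rfl fun η hη => ?_
  obtain ⟨h1, h2⟩ := Finset.mem_filter.1 hη
  rw [localVariance_flip hx0 hxn h1 h2]
  ring

end BiasedPaths

/-- The lower bound on the spectral gap. -/
def gapConst (α : ℝ) : ℝ :=
  Real.exp (-2 * α) / (1 + Real.exp (-2 * α)) ^ 2 / SkewArray.poincareConst (Real.exp (-α))

theorem gapConst_pos {α : ℝ} (hα : 0 < α) : 0 < gapConst α := by
  have := SkewArray.poincareConst_pos (Real.exp_pos (-α)) (by simpa using hα)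
  unfold gapConst
  positivity

theorem BiasedPaths.gapConst_le_gap {k n : ℕ} {h : ℤ} {α : ℝ} (hα : 0 < α) {ξ σ : Path n}
    (hξ : IsPath n h ξ) (hσ : IsPath n h σ) :
    (gapConst α : EReal) ≤ gap k n h α ξ σ := by
  refine le_iInf fun f => le_iInf fun hf => EReal.coe_le_coe_iff.2 ?_
  have hE : (E k n h ξ σ).Nonempty := by
    by_contra hne
    rw [Finset.not_nonempty_iff_eq_empty] at hne
    apply hf
    simp [variance, expect, hne]
  have hK := SkewArray.poincareConst_pos (Real.exp_pos (-α)) (by simpa using hα)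
  have h1 := variance_le_flips hα hσ hξ hE f
  have h2 := flips_le_dirichlet (h := h) (α := α) (ξ := ξ) (σ := σ) f
  have hvar : 0 ≤ variance k n h α ξ σ f :=
    SkewArray.variance_nonneg (fun η hη => muCond_pos hη) (sum_muCond hE) f
  have hvar' : 0 < variance k n h α ξ σ f := lt_of_le_of_ne hvar hf.symm
  rw [le_div_iff₀ hvar', gapConst, div_mul_eq_mul_div, div_le_iff₀ hK]
  have hc : 0 ≤ Real.exp (-2 * α) / (1 + Real.exp (-2 * α)) ^ 2 := by positivity
  calc _ ≤ _ := mul_le_mul_of_nonneg_left h1 hc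
    _ = SkewArray.poincareConst (Real.exp (-α)) * _ := mul_left_comm _ _ _
    _ ≤ _ := mul_le_mul_of_nonneg_left h2 hK.le
    _ = _ := mul_comm _ _

end

/-! ### Boxed plane partitions as arrays, and the gap of the flip dynamics. -/

noncomputable section

namespace BoxedPlanePartition

open Classical SkewArray

variable {a b c : ℕ} {α : ℝ}

/-- The position of a column of the box in the lattice of cells. -/
def cell (p : Fin a × Fin b) : ℤ × ℤ := ((p.1.val : ℤ) - p.2.val, -((p.1.val : ℤ) + p.2.val))

theorem cell_injective : Function.Injective (cell (a := a) (b := b)) := by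
  rintro ⟨u, v⟩ ⟨u', v'⟩ he
  simp only [cell, Prod.mk.injEq] at he
  ext <;> simp only <;> omega

/-- The cells of the box. -/
def boxCells (a b : ℕ) : Finset (ℤ × ℤ) := Finset.univ.image (cell (a := a) (b := b))

theorem cell_mem (p : Fin a × Fin b) : cell p ∈ boxCells a b :=
  Finset.mem_image_of_mem _ (Finset.mem_univ p)

theorem mem_boxCells {z m : ℤ} : (z, m) ∈ boxCells a b ↔
    ∃ (u : Fin a) (v : Fin b), (u.val : ℤ) - v.val = z ∧ -((u.val : ℤ) + v.val) = m := by
  unfold boxCells cell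
  simp only [Finset.mem_image, Finset.mem_univ, true_and, Prod.exists, Prod.mk.injEq]

/-- Two cells on one vertical at distance 2 are (u, v) and (u + 1, v + 1); the cells beside their
midpoint are the other corners (u, v + 1) and (u + 1, v). -/
theorem filled_boxCells : Filled (boxCells a b) := by
  intro z m h1 h2
  obtain ⟨u, v, h3, h4⟩ := mem_boxCells.1 h1
  obtain ⟨u', v', h5, h6⟩ := mem_boxCells.1 h2
  exact ⟨mem_boxCells.2 ⟨u, v', by omega, by omega⟩, mem_boxCells.2 ⟨u', v, by omega, by omega⟩⟩

/-- The array of column heights. -/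
def heights (l : Fin a → Fin b → ℤ) : ℤ × ℤ → ℕ :=
  Function.extend cell (fun p => (l p.1 p.2).toNat) 0

theorem heights_cell (l : Fin a → Fin b → ℤ) (u : Fin a) (v : Fin b) :
    heights l (cell (u, v)) = (l u v).toNat :=
  cell_injective.extend_apply _ _ (u, v)

theorem heights_of_notMem (l : Fin a → Fin b → ℤ) {p : ℤ × ℤ} (hp : p ∉ boxCells a b) :
    heights l p = 0 :=
  Function.extend_apply' _ _ _ fun ⟨q, hq⟩ => hp (Finset.mem_image.2 ⟨q, Finset.mem_univ q, hq⟩)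

theorem mem_states {l : Fin a → Fin b → ℤ} : l ∈ states a b c ↔
    (∀ x y, 0 ≤ l x y ∧ l x y ≤ c) ∧ (∀ x x' y, x ≤ x' → l x' y ≤ l x y) ∧
      ∀ x y y', y ≤ y' → l x y' ≤ l x y := by
  unfold states
  simp only [Finset.mem_filter, Fintype.mem_piFinset, Finset.mem_Icc]

/-- Increasing the first index moves to the lower right cell, increasing the second to the lower
left one, so entries decreasing in both indices become heights increasing upwards. -/
theorem isArray_heights {l : Fin a → Fin b → ℤ} (hl : l ∈ states a b c) :
    IsArray (boxCells a b) c (heights l) := by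
  obtain ⟨hb, hx, hy⟩ := mem_states.1 hl
  refine ⟨fun p hp => heights_of_notMem l hp, fun p => ?_, ?_, ?_⟩
  · by_cases hp : p ∈ boxCells a b
    · obtain ⟨⟨u, v⟩, -, rfl⟩ := Finset.mem_image.1 hp
      rw [heights_cell]
      have := hb u v
      omega
    · rw [heights_of_notMem l hp]
      exact Nat.zero_le _
  · intro p hp
    obtain ⟨⟨u, v⟩, -, rfl⟩ := Finset.mem_image.1 hp
    by_cases hp' : ((cell (u, v)).1 - 1, (cell (u, v)).2 - 1) ∈ boxCells a b
    · obtain ⟨⟨u', v'⟩, -, he⟩ := Finset.mem_image.1 hp'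
      rw [← he, heights_cell, heights_cell]
      simp only [cell, Prod.mk.injEq] at he
      have h1 : u' = u := by omega
      subst h1
      exact Int.toNat_le_toNat (hy u' v v' (by rw [Fin.le_def]; omega))
    · rw [heights_of_notMem l hp']
      exact Nat.zero_le _
  · intro p hp
    obtain ⟨⟨u, v⟩, -, rfl⟩ := Finset.mem_image.1 hp
    by_cases hp' : ((cell (u, v)).1 + 1, (cell (u, v)).2 - 1) ∈ boxCells a b
    · obtain ⟨⟨u', v'⟩, -, he⟩ := Finset.mem_image.1 hp'
      rw [← he, heights_cell, heights_cell]
      simp only [cell, Prod.mk.injEq] at he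
      have h1 : v' = v := by omega
      subst h1
      exact Int.toNat_le_toNat (hx u u' v' (by rw [Fin.le_def]; omega))
    · rw [heights_of_notMem l hp']
      exact Nat.zero_le _

theorem eq_of_heights_eq {l l' : Fin a → Fin b → ℤ} (hl : l ∈ states a b c)
    (hl' : l' ∈ states a b c) (he : heights l = heights l') : l = l' := by
  funext u v
  have h1 := congrFun he (cell (u, v))
  rw [heights_cell, heights_cell] at h1
  have h2 := (mem_states.1 hl).1 u v
  have h3 := (mem_states.1 hl').1 u v
  omega

/-- The array `l` with the entry at `(u, v)` replaced by `t`. -/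
def setEntry (l : Fin a → Fin b → ℤ) (u : Fin a) (v : Fin b) (t : ℤ) : Fin a → Fin b → ℤ :=
  Function.update l u (Function.update (l u) v t)

theorem setEntry_apply (l : Fin a → Fin b → ℤ) (u x : Fin a) (v y : Fin b) (t : ℤ) :
    setEntry l u v t x y = if x = u ∧ y = v then t else l x y := by
  unfold setEntry
  by_cases hx : x = u
  · subst hx
    rw [Function.update_self]
    by_cases hy : y = v
    · subst hy
      simp
    · rw [Function.update_of_ne hy, if_neg fun hc => hy hc.2]
  · rw [Function.update_of_ne hx, if_neg fun hc => hx hc.1]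

theorem setEntry_setEntry (l : Fin a → Fin b → ℤ) (u : Fin a) (v : Fin b) (t t' : ℤ) :
    setEntry (setEntry l u v t) u v t' = setEntry l u v t' := by
  unfold setEntry
  simp

theorem setEntry_self (l : Fin a → Fin b → ℤ) (u : Fin a) (v : Fin b) :
    setEntry l u v (l u v) = l := by
  unfold setEntry
  simp

theorem setEntry_apply_self (l : Fin a → Fin b → ℤ) (u : Fin a) (v : Fin b) (t : ℤ) :
    setEntry l u v t u v = t := by
  simp [setEntry_apply]

theorem setEntry_mem {l : Fin a → Fin b → ℤ} (hl : l ∈ states a b c) {u : Fin a} {v : Fin b}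
    {t : ℤ} (h0 : 0 ≤ t) (hc : t ≤ c)
    (hx1 : ∀ u' : Fin a, u'.val + 1 = u.val → t ≤ l u' v)
    (hx2 : ∀ u' : Fin a, u'.val = u.val + 1 → l u' v ≤ t)
    (hy1 : ∀ v' : Fin b, v'.val + 1 = v.val → t ≤ l u v')
    (hy2 : ∀ v' : Fin b, v'.val = v.val + 1 → l u v' ≤ t) : setEntry l u v t ∈ states a b c := by
  obtain ⟨hb, hx, hy⟩ := mem_states.1 hl
  refine mem_states.2 ⟨fun x y => ?_, fun x x' y hle => ?_, fun x y y' hle => ?_⟩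
  · rw [setEntry_apply]
    split_ifs
    · exact ⟨h0, hc⟩
    · exact hb x y
  · rw [setEntry_apply, setEntry_apply]
    split_ifs with h1 h2 h2
    · exact le_rfl
    · obtain ⟨rfl, rfl⟩ := h1
      have hlt : x.val < x'.val :=
        lt_of_le_of_ne hle fun hc => h2 ⟨Fin.ext hc, rfl⟩
      exact (hx1 ⟨x'.val - 1, by omega⟩ (by simp only; omega)).trans
        (hx _ _ _ (by rw [Fin.le_def]; simp only; omega))
    · obtain ⟨rfl, rfl⟩ := h2
      have hlt : x.val < x'.val :=
        lt_of_le_of_ne hle fun hc => h1 ⟨(Fin.ext hc).symm, rfl⟩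
      exact (hx _ _ _ (by rw [Fin.le_def]; simp only; omega)).trans
        (hx2 ⟨x.val + 1, by omega⟩ rfl)
    · exact hx x x' y hle
  · rw [setEntry_apply, setEntry_apply]
    split_ifs with h1 h2 h2
    · exact le_rfl
    · obtain ⟨rfl, rfl⟩ := h1
      have hlt : y.val < y'.val :=
        lt_of_le_of_ne hle fun hc => h2 ⟨rfl, Fin.ext hc⟩
      exact (hy1 ⟨y'.val - 1, by omega⟩ (by simp only; omega)).trans
        (hy _ _ _ (by rw [Fin.le_def]; simp only; omega))
    · obtain ⟨rfl, rfl⟩ := h2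
      have hlt : y.val < y'.val :=
        lt_of_le_of_ne hle fun hc => h1 ⟨rfl, (Fin.ext hc).symm⟩
      exact (hy _ _ _ (by rw [Fin.le_def]; simp only; omega)).trans
        (hy2 ⟨y.val + 1, by omega⟩ rfl)
    · exact hy x y y' hle

theorem heights_setEntry (l : Fin a → Fin b → ℤ) (u : Fin a) (v : Fin b) (t : ℤ) :
    heights (setEntry l u v t) = Function.update (heights l) (cell (u, v)) t.toNat := by
  funext p
  by_cases hp : p ∈ boxCells a b
  · obtain ⟨⟨u', v'⟩, -, rfl⟩ := Finset.mem_image.1 hp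
    rw [heights_cell, setEntry_apply]
    by_cases he : u' = u ∧ v' = v
    · rw [if_pos he, he.1, he.2, Function.update_self]
    · rw [if_neg he, Function.update_of_ne, heights_cell]
      intro hc
      exact he (by simpa using cell_injective hc)
  · rw [heights_of_notMem _ hp, Function.update_of_ne, heights_of_notMem _ hp]
    rintro rfl
    exact hp (cell_mem _)

theorem exists_add {l : Fin a → Fin b → ℤ} (hl : l ∈ states a b c) {s : ℤ × ℤ}
    (hs : s ∈ boxCells a b) (hlt : heights l s < hi (boxCells a b) c (heights l) s) :
    ∃ (u : Fin a) (v : Fin b), setEntry l u v (l u v + 1) ∈ states a b c ∧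
      heights (setEntry l u v (l u v + 1)) =
        Function.update (heights l) s (heights l s + 1) := by
  obtain ⟨⟨u, v⟩, -, rfl⟩ := Finset.mem_image.1 hs
  have hA := isArray_heights hl
  obtain ⟨hb, hx, hy⟩ := mem_states.1 hl
  have hk := hlt.trans_le ((min_le_left _ _).trans (hA.cap_le _))
  obtain ⟨h1, h2⟩ := lt_min_iff.1 hlt
  have hbuv := hb u v
  rw [heights_cell] at h1 h2 hk
  refine ⟨u, v, setEntry_mem hl (by omega) (by omega) ?_ ?_ ?_ ?_, ?_⟩
  · intro u' hu'
    have hc : ((cell (u, v)).1 - 1, (cell (u, v)).2 + 1) = cell (u', v) := by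
      simp only [cell, Prod.mk.injEq]
      omega
    rw [hc, cap, if_pos (cell_mem _), heights_cell] at h1
    omega
  · intro u' hu'
    have := hx u u' v (by rw [Fin.le_def]; omega)
    omega
  · intro v' hv'
    have hc : ((cell (u, v)).1 + 1, (cell (u, v)).2 + 1) = cell (u, v') := by
      simp only [cell, Prod.mk.injEq]
      omega
    rw [hc, cap, if_pos (cell_mem _), heights_cell] at h2
    omega
  · intro v' hv'
    have := hy u v v' (by rw [Fin.le_def]; omega)
    omega
  · rw [heights_setEntry, heights_cell]
    congr 1
    omega

theorem exists_remove {l : Fin a → Fin b → ℤ} (hl : l ∈ states a b c) {s : ℤ × ℤ}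
    (hs : s ∈ boxCells a b) (hlt : lo (heights l) s < heights l s) :
    ∃ l' ∈ states a b c, heights l' = Function.update (heights l) s (heights l s - 1) := by
  obtain ⟨⟨u, v⟩, -, rfl⟩ := Finset.mem_image.1 hs
  obtain ⟨hb, hx, hy⟩ := mem_states.1 hl
  obtain ⟨h1, h2⟩ := max_lt_iff.1 hlt
  have hbuv := hb u v
  rw [heights_cell] at h1 h2
  refine ⟨setEntry l u v (l u v - 1), setEntry_mem hl (by omega) (by omega) ?_ ?_ ?_ ?_, ?_⟩
  · intro u' hu'
    have := hx u' u v (by rw [Fin.le_def]; omega)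
    omega
  · intro u' hu'
    have hc : ((cell (u, v)).1 + 1, (cell (u, v)).2 - 1) = cell (u', v) := by
      simp only [cell, Prod.mk.injEq]
      omega
    rw [hc, heights_cell] at h2
    omega
  · intro v' hv'
    have := hy u v' v (by rw [Fin.le_def]; omega)
    omega
  · intro v' hv'
    have hc : ((cell (u, v)).1 - 1, (cell (u, v)).2 - 1) = cell (u, v') := by
      simp only [cell, Prod.mk.injEq]
      omega
    rw [hc, heights_cell] at h1
    omega
  · rw [heights_setEntry, heights_cell]
    congr 1
    omega

theorem weight_pos (l : Fin a → Fin b → ℤ) : 0 < weight α l := Real.exp_pos _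

theorem weight_add_one (l : Fin a → Fin b → ℤ) (u : Fin a) (v : Fin b) :
    weight α (setEntry l u v (l u v + 1)) = Real.exp (-2 * α) * weight α l := by
  unfold weight
  rw [← Real.exp_add]
  congr 1
  have h1 : ∀ x y, (setEntry l u v (l u v + 1) x y : ℝ) =
      l x y + if x = u then (if y = v then (1 : ℝ) else 0) else 0 := by
    intro x y
    rw [setEntry_apply]
    by_cases hx : x = u <;> by_cases hy : y = v <;> simp [hx, hy]
  simp only [h1, Finset.sum_add_distrib]
  have h2 : ∑ x : Fin a, ∑ y : Fin b, (if x = u then (if y = v then (1 : ℝ) else 0) else 0) = 1 := by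
    rw [Finset.sum_eq_single u (fun x _ hx => by simp [hx]) (by simp)]
    simp
  rw [h2]
  ring

/-- The normalized equilibrium weight. -/
def prob (a b c : ℕ) (α : ℝ) (l : Fin a → Fin b → ℤ) : ℝ :=
  weight α l / ∑ l' ∈ states a b c, weight α l'

theorem expect_eq (f : (Fin a → Fin b → ℤ) → ℝ) :
    expect a b c α f = ∑ l ∈ states a b c, prob a b c α l * f l := by
  unfold expect prob
  rw [Finset.sum_div]
  exact Finset.sum_congr rfl fun l _ => by ring

theorem sum_weight_pos {l : Fin a → Fin b → ℤ} (hl : l ∈ states a b c) :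
    0 < ∑ l' ∈ states a b c, weight α l' :=
  Finset.sum_pos (fun l' _ => weight_pos l') ⟨l, hl⟩

theorem prob_pos {l : Fin a → Fin b → ℤ} (hl : l ∈ states a b c) : 0 < prob a b c α l :=
  div_pos (weight_pos l) (sum_weight_pos hl)

theorem sum_prob (hne : (states a b c).Nonempty) : ∑ l ∈ states a b c, prob a b c α l = 1 := by
  obtain ⟨l, hl⟩ := hne
  unfold prob
  rw [← Finset.sum_div, div_self (sum_weight_pos hl).ne']

theorem prob_add_one (l : Fin a → Fin b → ℤ) (u : Fin a) (v : Fin b) :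
    prob a b c α (setEntry l u v (l u v + 1)) = Real.exp (-2 * α) * prob a b c α l := by
  unfold prob
  rw [weight_add_one, mul_div_assoc]

theorem variance_le_flips (hα : 0 < α) (hne : (states a b c).Nonempty)
    (f : (Fin a → Fin b → ℤ) → ℝ) :
    variance a b c α f ≤ poincareConst (Real.exp (-α)) *
      ∑ j : Fin a × Fin b, ∑ l ∈ (states a b c).filter
          (fun l => setEntry l j.1 j.2 (l j.1 j.2 + 1) ∈ states a b c),
          prob a b c α l * (f (setEntry l j.1 j.2 (l j.1 j.2 + 1)) - f l) ^ 2 := by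
  have main := variance_le_of_encoding (Y := states a b c) (w := prob a b c α)
    (r := Real.exp (-α)) (Real.exp_pos _) (by simpa using hα) filled_boxCells heights
    (Finset.univ : Finset (Fin a × Fin b)) (fun j l => setEntry l j.1 j.2 (l j.1 j.2 + 1))
    (fun l h1 l' h2 e => eq_of_heights_eq h1 h2 e) (fun l h1 => prob_pos h1)
    (sum_prob hne) (fun l h1 => isArray_heights h1) ?_
    (fun l h1 s hs hlt => exists_remove h1 hs hlt) f
  · unfold variance
    rw [expect_eq, expect_eq]
    convert main
  intro l h1 s hs hlt
  obtain ⟨u, v, h2, h3⟩ := exists_add h1 hs hlt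
  refine ⟨(u, v), Finset.mem_univ _, h2, h3, ?_⟩
  simp only
  rw [prob_add_one]
  congr 1
  rw [← Real.exp_nat_mul]
  congr 1
  push_cast
  ring

/-- Detailed balance, (1 - p) exp(-2α) = p, matches each downward flip with its reverse upward flip
from l to l', and f(l)(f(l') - f(l)) + f(l')(f(l) - f(l')) = -(f(l') - f(l))^2. -/
theorem sum_mul_flip (f : (Fin a → Fin b → ℤ) → ℝ) (u : Fin a) (v : Fin b) :
    ∑ l ∈ states a b c, prob a b c α l * (f l * (pUp α * (f (flip c l u v 1) - f l) +
      (1 - pUp α) * (f (flip c l u v (-1)) - f l))) =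
      -(pUp α * ∑ l ∈ (states a b c).filter
        (fun l => setEntry l u v (l u v + 1) ∈ states a b c),
        prob a b c α l * (f (setEntry l u v (l u v + 1)) - f l) ^ 2) := by
  have hflip : ∀ d : ℤ, ∑ l ∈ states a b c, prob a b c α l * (f l * (f (flip c l u v d) - f l)) =
      ∑ l ∈ (states a b c).filter (fun l => setEntry l u v (l u v + d) ∈ states a b c),
        prob a b c α l * (f l * (f (setEntry l u v (l u v + d)) - f l)) := by
    intro d
    rw [Finset.sum_filter]
    refine Finset.sum_congr rfl fun l _ => ?_
    unfold flip
    change _ * (_ * (f (if setEntry l u v (l u v + d) ∈ states a b c then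
      setEntry l u v (l u v + d) else l) - _)) = _
    split_ifs
    · rfl
    · rw [sub_self, mul_zero, mul_zero]
  have hdown : ∑ l ∈ (states a b c).filter
        (fun l => setEntry l u v (l u v + -1) ∈ states a b c),
        prob a b c α l * (f l * (f (setEntry l u v (l u v + -1)) - f l)) =
      ∑ l ∈ (states a b c).filter (fun l => setEntry l u v (l u v + 1) ∈ states a b c),
        Real.exp (-2 * α) * prob a b c α l * (f (setEntry l u v (l u v + 1)) *
          (f l - f (setEntry l u v (l u v + 1)))) := by
    refine Finset.sum_nbij' (fun l => setEntry l u v (l u v + -1))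
      (fun l => setEntry l u v (l u v + 1)) ?_ ?_ ?_ ?_ ?_
    · intro l hl
      obtain ⟨h1, h2⟩ := Finset.mem_filter.1 hl
      refine Finset.mem_filter.2 ⟨h2, ?_⟩
      rwa [setEntry_apply_self, setEntry_setEntry, neg_add_cancel_right, setEntry_self]
    · intro l hl
      obtain ⟨h1, h2⟩ := Finset.mem_filter.1 hl
      refine Finset.mem_filter.2 ⟨h2, ?_⟩
      rwa [setEntry_apply_self, setEntry_setEntry, add_neg_cancel_right, setEntry_self]
    · intro l _
      rw [setEntry_apply_self, setEntry_setEntry, neg_add_cancel_right, setEntry_self]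
    · intro l _
      rw [setEntry_apply_self, setEntry_setEntry, add_neg_cancel_right, setEntry_self]
    · intro l _
      rw [← prob_add_one, setEntry_apply_self, setEntry_setEntry, neg_add_cancel_right,
        setEntry_self]
  have hp : (1 - pUp α) * Real.exp (-2 * α) = pUp α := by
    have : 0 < Real.exp (-2 * α) := Real.exp_pos _
    unfold pUp
    field_simp
    ring
  have hsplit : ∑ l ∈ states a b c, prob a b c α l * (f l * (pUp α * (f (flip c l u v 1) - f l) +
      (1 - pUp α) * (f (flip c l u v (-1)) - f l))) =
      pUp α * ∑ l ∈ states a b c, prob a b c α l * (f l * (f (flip c l u v 1) - f l)) +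
      (1 - pUp α) *
        ∑ l ∈ states a b c, prob a b c α l * (f l * (f (flip c l u v (-1)) - f l)) := by
    rw [Finset.mul_sum, Finset.mul_sum, ← Finset.sum_add_distrib]
    exact Finset.sum_congr rfl fun l _ => by ring
  rw [hsplit, hflip, hflip, hdown, Finset.mul_sum, Finset.mul_sum, Finset.mul_sum,
    ← Finset.sum_add_distrib, ← Finset.sum_neg_distrib]
  refine Finset.sum_congr rfl fun l _ => ?_
  linear_combination (prob a b c α l * (f (setEntry l u v (l u v + 1)) *
    (f l - f (setEntry l u v (l u v + 1))))) * hp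

theorem dirichlet_eq (f : (Fin a → Fin b → ℤ) → ℝ) :
    dirichlet a b c α f = pUp α * ∑ j : Fin a × Fin b, ∑ l ∈ (states a b c).filter
      (fun l => setEntry l j.1 j.2 (l j.1 j.2 + 1) ∈ states a b c),
      prob a b c α l * (f (setEntry l j.1 j.2 (l j.1 j.2 + 1)) - f l) ^ 2 := by
  unfold dirichlet generator
  rw [expect_eq]
  simp only [Finset.mul_sum]
  rw [Finset.sum_comm, ← Finset.univ_product_univ, Finset.sum_product, ← Finset.sum_neg_distrib]
  refine Finset.sum_congr rfl fun u _ => ?_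
  rw [Finset.sum_comm, ← Finset.sum_neg_distrib]
  refine Finset.sum_congr rfl fun v _ => ?_
  rw [sum_mul_flip, neg_neg, Finset.mul_sum]

theorem gapConst_le_gap (hα : 0 < α) : (gapConst α : EReal) ≤ gap a b c α := by
  refine le_iInf fun f => le_iInf fun hf => EReal.coe_le_coe_iff.2 ?_
  have hne : (states a b c).Nonempty := by
    by_contra hne
    rw [Finset.not_nonempty_iff_eq_empty] at hne
    apply hf
    simp [variance, expect, hne]
  have hK := poincareConst_pos (Real.exp_pos (-α)) (by simpa using hα)
  have h1 := variance_le_flips hα hne f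
  have hvar : 0 ≤ variance a b c α f := by
    unfold variance
    rw [expect_eq, expect_eq]
    exact variance_nonneg (fun l hl => prob_pos hl) (sum_prob hne) f
  have hvar' : 0 < variance a b c α f := lt_of_le_of_ne hvar hf.symm
  have hp : 0 < pUp α := by
    unfold pUp
    positivity
  -- The flip rate q/(1 + q) exceeds the Bernoulli variance q/(1 + q)^2 of the polymer heat bath, so
  -- one constant serves both dynamics.
  have hc : Real.exp (-2 * α) / (1 + Real.exp (-2 * α)) ^ 2 ≤ pUp α := by
    have : 0 < Real.exp (-2 * α) := Real.exp_pos _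
    unfold pUp
    refine div_le_div_of_nonneg_left this.le (by positivity) ?_
    nlinarith
  rw [le_div_iff₀ hvar', gapConst, div_mul_eq_mul_div, div_le_iff₀ hK, dirichlet_eq]
  calc _ ≤ pUp α * variance a b c α f := mul_le_mul_of_nonneg_right hc hvar
    _ ≤ pUp α * _ := mul_le_mul_of_nonneg_left h1 hp.le
    _ = _ := by ring

end BoxedPlanePartition

end

theorem theorem1 (α : ℝ) (hα : 0 < α) :
    ∃ C : ℝ, 0 < C ∧
      (∀ (k n : ℕ) (_ : 1 ≤ k) (_ : 1 ≤ n) (h : ℤ) (_ : |h| ≤ (n : ℤ))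
        (ξ σ : BiasedPaths.Path n)
        (_ : BiasedPaths.IsPath n h ξ) (_ : BiasedPaths.IsPath n h σ)
        (_ : ∀ x, σ x ≤ ξ x),
        (C : EReal) ≤ BiasedPaths.gap k n h α ξ σ) ∧
      (∀ a b c : ℕ, (C : EReal) ≤ BoxedPlanePartition.gap a b c α) :=
  ⟨gapConst α, gapConst_pos hα,
    fun _ _ _ _ _ _ _ _ hξ hσ _ => BiasedPaths.gapConst_le_gap hα hξ hσ,
    fun _ _ _ => BoxedPlanePartition.gapConst_le_gap hα⟩
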